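/- An instance of Multiway Cut with $k\ge 1$ terminals consists of a finite graph $G=(V,E)$ with weights $w:E\to\mathbb R_{\ge 0}$ and distinct vertices $t_1,\dots,t_k\in V$; a multiway cut is a set $F\subseteq E$ such that no two terminals are connected in $(V,E\setminus F)$, and one wants to minimize $w(F)$. Let $\Delta=\{x\in\mathbb R^k: x\ge 0,\ \sum_i x_i=1\}$. The CKR relaxation is to minimize $\mathrm{LP}(x)=\sum_{(u,v)\in E} w_{uv}\,\tfrac12\|x_u-x_v\|_1$ over all $x:V\to\Delta$ with $x_{t_i}=\mathbf 1_i$ (the $i$-th unit vector) for all $i$. A rounding scheme is a probability distribution over labelings $\ell:\Delta\to[k]$; applied to $x:V\to\Delta$ it outputs the set of edges $(u,v)$ with $\ell(x_u)\ne\ell(x_v)$. For $i\ne j$, the cut density of a scheme for edges of type $(i,j)$ at $x\in\Delta$ is $$d_{ij}(x)=\limsup_{\varepsilon\to 0^+}\ \frac1\varepsilon\Pr\big[\ell(x)\ne\ell(x+\varepsilon\mathbf 1_i-\varepsilon\mathbf 1_j)\big],$$ where $\varepsilon$ ranges over the values with $x+\varepsilon\mathbf 1_i-\varepsilon\mathbf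 1_j\in\Delta$ (and $d_{ij}(x)=0$ if there are no such $\varepsilon>0$). Consider three schemes. * Exponential Clocks: $Z_1,\dots,Z_k$ are independent exponential variables of rate $1$, and $\ell(x)=\arg\min_i Z_i/x_i$ (with $Z_i/0=\infty$). * Single Threshold with density $\phi$: choose $\theta$ with density $\phi$ and, independently, a uniformly random permutation $\sigma$ of $[k]$; $\ell(x)=\sigma(i)$ for the least $i\le k-1$ with $x_{\sigma(i)}\ge\theta$, and $\ell(x)=\sigma(k)$ if there is none. * Descending Thresholds with density $\psi$: choose independent $\theta_1,\dots,\theta_k$ with density $\psi$ and a permutation $\sigma$ with $\theta_{\sigma(1)}\ge\dots\ge\theta_{\sigma(k)}$; $\ell(x)=\sigma(i)$ for the least $i\le k-1$ with $x_{\sigma(i)}\ge\theta_{\sigma(i)}$, and $\ell(x)=\sigma(k)$ if there is none. Let $p_1=\frac{6+5\sqrt3}{26}$, $p_2=\frac{19-8\sqrt3}{13}$, $p_3=\frac{11\sqrt3-18}{26}$, $b=2\sqrt3-3$, and let $a,c,d$ be given by $p_2a=\frac{12+10\sqrt3}{39}$, $p_2c=\frac{6+5\sqrt3}{26}$, $p_2d=\frac{4-\sqrt3}{13}$.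 Let $\phi(u)=au$ on $[0,b]$, $\phi(u)=cu+d$ on $(b,1]$, and $\psi(u)=1/b$ on $[0,b]$, $\psi(u)=0$ on $(b,1]$ (both densities are $0$ outside $[0,1]$). Then $p_1,p_2,p_3\ge0$, $p_1+p_2+p_3=1$, $0<b<1$, and $\phi,\psi$ are probability densities. Let $\mathcal R$ be the rounding scheme that uses Exponential Clocks with probability $p_1$, Single Threshold with density $\phi$ with probability $p_2$, and Descending Thresholds with density $\psi$ with probability $p_3$. **Theorem.** $\mathcal R$ gives a $\frac{10+4\sqrt3}{13}\approx1.30217$-approximation for Multiway Cut. More precisely, for every $k\ge1$: 1. $d_{ij}(x)\le\frac{10+4\sqrt3}{13}$ for all $i\neq j$ and all $x\in\Delta$. 2. For every instance with $k$ terminals and every feasible solution $x$ of the CKR relaxation, almost surely $\ell(x_{t_i})=i$ for all $i$ and the output of $\mathcal R$ is a multiway cut, and its expected weight is at most $\frac{10+4\sqrt3}{13}\,\mathrm{LP}(x)$. The relaxation has an optimal solution, and for every optimal $x$ the expected weight is at most $\frac{10+4\sqrt3}{13}\,w(F)$ for every multiway cut $F$. -/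

import Mathlib

open MeasureTheory Filter Topology
open scoped ENNReal

noncomputable section

namespace MultiwayCut

/-- A labeling assigns one of the `k` terminals to each point. Only its values on the simplex
`stdSimplex ℝ (Fin k)` matter. -/
abbrev Labeling (k : ℕ) : Type := (Fin k → ℝ) → Fin k

/-- The distribution on `ℝ` with density `f` with respect to the Lebesgue measure. -/
def densityMeasure (f : ℝ → ℝ) : Measure ℝ :=
  volume.withDensity (fun u => ENNReal.ofReal (f u))

/-! ### Exponential clocks -/

/-- The ratio `Z i / x i`, equal to `∞` when `x i = 0 < Z i`. -/
def clockRatio {k : ℕ} (Z x : Fin k → ℝ) (i : Fin k) : ℝ≥0∞ :=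
  ENNReal.ofReal (Z i) / ENNReal.ofReal (x i)

open Classical in
/-- The indices at which `Z i / x i` is minimal. -/
def clockMinimizers {k : ℕ} (Z x : Fin k → ℝ) : Finset (Fin k) :=
  Finset.univ.filter fun i => ∀ j, clockRatio Z x i ≤ clockRatio Z x j

theorem clockMinimizers_nonempty {k : ℕ} [NeZero k] (Z x : Fin k → ℝ) :
    (clockMinimizers Z x).Nonempty := by
  obtain ⟨i, -, hi⟩ := Finset.exists_min_image Finset.univ (clockRatio Z x)
    ⟨(0 : Fin k), Finset.mem_univ _⟩
  exact ⟨i, by simpa [clockMinimizers] using fun j => hi j (Finset.mem_univ j)⟩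

/-- `argmin_i Z i / x i` (the least minimizer in case of a tie). -/
def clockLabel {k : ℕ} [NeZero k] (Z : Fin k → ℝ) : Labeling k :=
  fun x => (clockMinimizers Z x).min' (clockMinimizers_nonempty Z x)

/-- The Exponential Clocks scheme: label `x` by `argmin_i Z i / x i`, where the `Z i` are
independent exponential variables. -/
def exponentialClocks (k : ℕ) [NeZero k] : Measure (Labeling k) :=
  Measure.map clockLabel (Measure.pi fun _ : Fin k => ProbabilityTheory.expMeasure 1)

/-! ### Threshold schemes -/

open Classical in
/-- The positions `i` of the order `σ` at which `x` may be assigned: those where `x` passes the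
threshold of terminal `σ i`, and the last position, which takes every remaining point. -/
def stops {k : ℕ} (θ : Fin k → ℝ) (σ : Equiv.Perm (Fin k)) (x : Fin k → ℝ) : Finset (Fin k) :=
  Finset.univ.filter fun i => θ (σ i) ≤ x (σ i) ∨ (i : ℕ) + 1 = k

theorem stops_nonempty {k : ℕ} [NeZero k] (θ : Fin k → ℝ) (σ : Equiv.Perm (Fin k))
    (x : Fin k → ℝ) : (stops θ σ x).Nonempty := by
  have hk : 0 < k := Nat.pos_of_ne_zero (NeZero.ne k)
  refine ⟨⟨k - 1, by omega⟩, ?_⟩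
  simp only [stops, Finset.mem_filter, Finset.mem_univ, true_and]
  right
  omega

/-- Go over the terminals in the order `σ` and assign `x` to the first terminal `σ i` with
`x (σ i) ≥ θ (σ i)`; if none of the first `k - 1` terminals takes `x`, assign it to the last. -/
def thresholdLabel {k : ℕ} [NeZero k] (θ : Fin k → ℝ) (σ : Equiv.Perm (Fin k)) : Labeling k :=
  fun x => σ ((stops θ σ x).min' (stops_nonempty θ σ x))

/-- The Single Threshold scheme: one threshold with density `φ` for all terminals, and an
independent uniformly random order of the terminals. -/
def singleThreshold (k : ℕ) [NeZero k] (φ : ℝ → ℝ) : Measure (Labeling k) :=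
  (Fintype.card (Equiv.Perm (Fin k)) : ℝ≥0∞)⁻¹ •
    ∑ σ : Equiv.Perm (Fin k),
      Measure.map (fun θ : ℝ => thresholdLabel (fun _ => θ) σ) (densityMeasure φ)

/-- An order of the terminals along which the thresholds are descending. -/
def descendingOrder {k : ℕ} (θ : Fin k → ℝ) : Equiv.Perm (Fin k) :=
  Tuple.sort fun i => -θ i

theorem descendingOrder_antitone {k : ℕ} (θ : Fin k → ℝ) :
    Antitone fun i => θ (descendingOrder θ i) := by
  intro i j hij
  have h := Tuple.monotone_sort (fun i => -θ i) hij
  simpa [descendingOrder] using h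

/-- The Descending Thresholds scheme: independent thresholds with density `ψ`, one for each
terminal, applied in descending order. -/
def descendingThresholds (k : ℕ) [NeZero k] (ψ : ℝ → ℝ) : Measure (Labeling k) :=
  Measure.map (fun θ : Fin k → ℝ => thresholdLabel θ (descendingOrder θ))
    (Measure.pi fun _ : Fin k => densityMeasure ψ)

/-! ### The combined algorithm -/

/-- The density `a u` on `[0, b]` and `c u + d` on `(b, 1]`. -/
def phi (a b c d : ℝ) (u : ℝ) : ℝ :=
  if 0 ≤ u ∧ u ≤ b then a * u else if b < u ∧ u ≤ 1 then c * u + d else 0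

/-- The uniform density on `[0, b]`. -/
def psi (b : ℝ) (u : ℝ) : ℝ :=
  if 0 ≤ u ∧ u ≤ b then 1 / b else 0

/-- With probability `p₁` use Exponential Clocks, with probability `p₂` use Single Threshold with
density `phi a b c d`, with probability `p₃` use Descending Thresholds with density `psi b`. -/
def combinedScheme (k : ℕ) [NeZero k] (p₁ p₂ p₃ a b c d : ℝ) : Measure (Labeling k) :=
  ENNReal.ofReal p₁ • exponentialClocks k
    + ENNReal.ofReal p₂ • singleThreshold k (phi a b c d)
    + ENNReal.ofReal p₃ • descendingThresholds k (psi b)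

/-! ### Cut density -/

/-- The point `x + ε 1_i - ε 1_j`. -/
def shift {k : ℕ} (x : Fin k → ℝ) (i j : Fin k) (ε : ℝ) : Fin k → ℝ :=
  x + Pi.single i ε - Pi.single j ε

/-- The cut density of the scheme `R` for edges of type `(i, j)` at `x`: the upper limit, as
`ε → 0+` through the values for which the second endpoint lies in the simplex, of the probability
of cutting the edge divided by its length `ε`. -/
def cutDensity {k : ℕ} (R : Measure (Labeling k)) (i j : Fin k) (x : Fin k → ℝ) : ℝ≥0∞ :=
  limsup (fun ε : ℝ => R {ℓ | ℓ x ≠ ℓ (shift x i j ε)} / ENNReal.ofReal ε)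
    (𝓝[{ε : ℝ | 0 < ε ∧ shift x i j ε ∈ stdSimplex ℝ (Fin k)}] 0)

/-! ### The Multiway Cut problem and its simplex relaxation -/

/-- An instance of Multiway Cut: a graph with nonnegative edge weights and `k` distinct
terminals. -/
structure Problem (V : Type*) (k : ℕ) where
  graph : SimpleGraph V
  weight : Sym2 V → ℝ
  weight_nonneg : ∀ e ∈ graph.edgeSet, 0 ≤ weight e
  terminal : Fin k ↪ V

namespace Problem

variable {V : Type*} {k : ℕ}

/-- `F` is a set of edges whose removal disconnects every pair of terminals. -/
def IsMultiwayCut (P : Problem V k) (F : Finset (Sym2 V)) : Prop :=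
  (F : Set (Sym2 V)) ⊆ P.graph.edgeSet ∧
    ∀ i j, i ≠ j →
      ¬ (P.graph.deleteEdges (F : Set (Sym2 V))).Reachable (P.terminal i) (P.terminal j)

/-- The total weight of a set of edges. -/
def cost (P : Problem V k) (F : Finset (Sym2 V)) : ℝ :=
  ∑ e ∈ F, P.weight e

open Classical in
/-- The edges whose endpoints get different labels. -/
def cutEdges [Fintype V] (P : Problem V k) (lab : V → Fin k) : Finset (Sym2 V) :=
  Finset.univ.filter fun e => e ∈ P.graph.edgeSet ∧ ¬ (Sym2.map lab e).IsDiag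

/-- `x` is feasible for the simplex relaxation: every vertex is mapped into the simplex, and the
`i`-th terminal to its `i`-th vertex. -/
def IsFeasible (P : Problem V k) (x : V → Fin k → ℝ) : Prop :=
  (∀ v, x v ∈ stdSimplex ℝ (Fin k)) ∧ ∀ i, x (P.terminal i) = Pi.single i 1

/-- Half the `ℓ₁` distance of the endpoints of an edge. -/
def edgeLength (x : V → Fin k → ℝ) : Sym2 V → ℝ :=
  Sym2.lift ⟨fun u v => (1 / 2) * ∑ i, |x u i - x v i|, fun u v => by
    simp only [abs_sub_comm]⟩

open Classical in
/-- The objective of the relaxation: the weighted sum of the edge lengths. -/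
def relaxedCost [Fintype V] (P : Problem V k) (x : V → Fin k → ℝ) : ℝ :=
  ∑ e ∈ Finset.univ.filter (fun e => e ∈ P.graph.edgeSet), P.weight e * edgeLength x e

/-- `x` is an optimal solution of the simplex relaxation. -/
def IsOptimal [Fintype V] (P : Problem V k) (x : V → Fin k → ℝ) : Prop :=
  P.IsFeasible x ∧ ∀ y, P.IsFeasible y → P.relaxedCost x ≤ P.relaxedCost y

end Problem

end MultiwayCut

end

open MultiwayCut

namespace MultiwayCut

/-! ### Measurability of the labels -/

section Measurability

variable {k : ℕ}

/-! Consider an edge from `x` to `x + ε 1_i - ε 1_j`, and let `s ≤ t` be the values of `x i` and `x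
j` in increasing order. Up to errors vanishing with `ε`, each scheme cuts the edge at a rate bounded
in terms of `s` and `t` alone. Exponential Clocks: `2 - s - t` (`exponentialClocks_cut_le`). Single
Threshold: `φ(s)/2 + φ(t)`, because a threshold near `s` is also passed by the larger coordinate,
whose terminal comes first in half of the orders. Descending Thresholds: `ψ(s)(1 - ∫_s^t ψ) + ψ(t)`,
because a threshold of the larger coordinate in `(s, t]` exceeds the one near `s`, so its terminal
comes first and takes both endpoints.

The parameters balance the mixture of these rates: it is constantly `(10 + 4√3)/13` for `s ≤ t ≤ b`
and for `s ≤ b < t`, and at most that for `b ≤ s ≤ t` (`density_low_low`, `density_low_high`,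
`density_high_high`). This bounds the cut density.

The infinitesimal bound integrates along a segment of type `(i, j)` by a mean value inequality for
right slopes (`real_label_ne_shift_le`). Any two points of the simplex are joined by such segments
with no waste in `ℓ₁` length (`real_label_ne_le_half_dist`), so every edge is cut with probability
at most the constant times its length. Linearity of expectation then compares the expected weight
with the relaxation. A multiway cut `F` yields an integral feasible solution of cost at most `w(F)`,
obtained by labeling each component of the remaining graph by its terminal, so the optimum of the
relaxation is at most `w(F)`. -/

theorem measurableSet_forall {α : Type*} [MeasurableSpace α] {ι : Sort*} [Countable ι]
    {p : ι → α → Prop} (h : ∀ i, MeasurableSet {a | p i a}) : MeasurableSet {a | ∀ i, p i a} := by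
  rw [Set.ofPred_forall]
  exact MeasurableSet.iInter h

theorem clockLabel_eq_iff [NeZero k] (Z x : Fin k → ℝ) (l : Fin k) :
    clockLabel Z x = l ↔ (∀ j, clockRatio Z x l ≤ clockRatio Z x j) ∧
      ∀ m, m < l → ¬ ∀ j, clockRatio Z x m ≤ clockRatio Z x j := by
  rw [clockLabel, Finset.min'_eq_iff]
  simp only [clockMinimizers, Finset.mem_filter, Finset.mem_univ, true_and]
  exact and_congr_right fun _ => forall_congr' fun m =>
    ⟨fun h hm hj => absurd (h hj) (not_le.2 hm), fun h hj => not_lt.1 fun hm => h hm hj⟩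

theorem measurable_clockRatio (x : Fin k → ℝ) (i : Fin k) :
    Measurable fun Z : Fin k → ℝ => clockRatio Z x i := by
  unfold clockRatio
  fun_prop

theorem measurable_clockLabel [NeZero k] : Measurable (clockLabel : (Fin k → ℝ) → Labeling k) := by
  refine measurable_pi_lambda _ fun x => measurable_to_countable' fun l => ?_
  have hle : ∀ m, MeasurableSet
      {Z : Fin k → ℝ | ∀ j, clockRatio Z x m ≤ clockRatio Z x j} := fun m =>
    measurableSet_forall fun j =>
      measurableSet_le (measurable_clockRatio x m) (measurable_clockRatio x j)
  have : (fun Z : Fin k → ℝ => clockLabel Z x) ⁻¹' {l} =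
      {Z | (∀ j, clockRatio Z x l ≤ clockRatio Z x j) ∧
        ∀ m, m < l → ¬ ∀ j, clockRatio Z x m ≤ clockRatio Z x j} := by
    ext Z
    exact clockLabel_eq_iff Z x l
  rw [this]
  exact (hle l).inter (measurableSet_forall fun m =>
    measurableSet_forall fun _ => (hle m).compl)

theorem mem_stops {θ : Fin k → ℝ} {σ : Equiv.Perm (Fin k)} {x : Fin k → ℝ} {i : Fin k} :
    i ∈ stops θ σ x ↔ θ (σ i) ≤ x (σ i) ∨ (i : ℕ) + 1 = k := by
  simp [stops]

theorem thresholdLabel_eq_iff [NeZero k] (θ : Fin k → ℝ) (σ : Equiv.Perm (Fin k)) (x : Fin k → ℝ)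
    (l : Fin k) : thresholdLabel θ σ x = l ↔
      σ.symm l ∈ stops θ σ x ∧ ∀ i, i < σ.symm l → i ∉ stops θ σ x := by
  rw [thresholdLabel, ← Equiv.eq_symm_apply, Finset.min'_eq_iff]
  exact and_congr_right fun _ => forall_congr' fun m =>
    ⟨fun h hm hj => absurd (h hj) (not_le.2 hm), fun h hj => not_lt.1 fun hm => h hm hj⟩

theorem measurable_thresholdLabel [NeZero k] (σ : Equiv.Perm (Fin k)) :
    Measurable fun θ : Fin k → ℝ => thresholdLabel θ σ := by
  refine measurable_pi_lambda _ fun x => measurable_to_countable' fun l => ?_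
  have hmem : ∀ i, MeasurableSet {θ : Fin k → ℝ | i ∈ stops θ σ x} := fun i => by
    simp only [mem_stops]
    exact (measurableSet_le (measurable_pi_apply _) measurable_const).union
      (MeasurableSet.const _)
  have : (fun θ : Fin k → ℝ => thresholdLabel θ σ x) ⁻¹' {l} =
      {θ | σ.symm l ∈ stops θ σ x ∧ ∀ i, i < σ.symm l → i ∉ stops θ σ x} := by
    ext θ
    exact thresholdLabel_eq_iff θ σ x l
  rw [this]
  exact (hmem _).inter (measurableSet_forall fun m =>
    measurableSet_forall fun _ => (hmem m).compl)

/-- Each fibre is given by finitely many coordinate comparisons: `Tuple.sort` is the unique sorting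
order that breaks ties by index. -/
theorem measurable_descendingOrder :
    Measurable[_, ⊤] (descendingOrder : (Fin k → ℝ) → Equiv.Perm (Fin k)) := by
  let : MeasurableSpace (Equiv.Perm (Fin k)) := ⊤
  refine measurable_to_countable' fun σ => ?_
  have : (descendingOrder : (Fin k → ℝ) → Equiv.Perm (Fin k)) ⁻¹' {σ} =
      {θ | (∀ i j, i ≤ j → -θ (σ i) ≤ -θ (σ j)) ∧
        ∀ i j, i < j → -θ (σ i) = -θ (σ j) → σ i < σ j} := by
    ext θ
    simp only [Set.mem_preimage, Set.mem_singleton_iff, descendingOrder, Set.mem_ofPred_eq]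
    rw [eq_comm, Tuple.eq_sort_iff]
    rfl
  rw [this]
  have hm : ∀ i : Fin k, Measurable fun θ : Fin k → ℝ => -θ (σ i) := fun i =>
    (measurable_pi_apply _).neg
  refine MeasurableSet.inter ?_ ?_
  · exact measurableSet_forall fun i => measurableSet_forall fun j =>
      measurableSet_forall fun _ => measurableSet_le (hm i) (hm j)
  · exact measurableSet_forall fun i => measurableSet_forall fun j =>
      measurableSet_forall fun _ =>
        (measurableSet_eq_fun (hm i) (hm j)).imp (MeasurableSet.const _)

theorem measurable_descendingLabel [NeZero k] :
    Measurable fun θ : Fin k → ℝ => thresholdLabel θ (descendingOrder θ) := by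
  let : MeasurableSpace (Equiv.Perm (Fin k)) := ⊤
  have h : Measurable fun p : Equiv.Perm (Fin k) × (Fin k → ℝ) => thresholdLabel p.2 p.1 :=
    measurable_from_prod_countable_right fun σ => measurable_thresholdLabel σ
  exact h.comp (measurable_descendingOrder.prodMk measurable_id)

theorem measurable_singleThresholdLabel [NeZero k] (σ : Equiv.Perm (Fin k)) :
    Measurable fun θ : ℝ => thresholdLabel (fun _ : Fin k => θ) σ :=
  (measurable_thresholdLabel σ).comp (measurable_pi_lambda _ fun _ => measurable_id)

theorem measurableSet_label_ne (x y : Fin k → ℝ) :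
    MeasurableSet {ℓ : Labeling k | ℓ x ≠ ℓ y} :=
  (measurableSet_eq_fun (measurable_pi_apply x) (measurable_pi_apply y)).compl

theorem measurableSet_label_eq (x : Fin k → ℝ) (l : Fin k) :
    MeasurableSet {ℓ : Labeling k | ℓ x = l} :=
  measurableSet_eq_fun (measurable_pi_apply x) measurable_const

end Measurability

/-! ### Points which a threshold scheme does not separate -/

section ThresholdCut

variable {k : ℕ}

/-- Only positions up to the first stop matter, so a comparison on which `x` and `y` disagree is
harmless once a terminal earlier in the order takes both points. -/
theorem thresholdLabel_congr [NeZero k] {θ : Fin k → ℝ} {σ : Equiv.Perm (Fin k)} {x y : Fin k → ℝ}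
    (h : ∀ l, (θ l ≤ x l ↔ θ l ≤ y l) ∨
      ∃ m, θ m ≤ x m ∧ θ m ≤ y m ∧ σ.symm m < σ.symm l) :
    thresholdLabel θ σ x = thresholdLabel θ σ y := by
  have key : ∀ i, (∀ j, j < i → j ∉ stops θ σ x ∨ j ∉ stops θ σ y) →
      (i ∈ stops θ σ x ↔ i ∈ stops θ σ y) := by
    intro i hi
    rcases h (σ i) with h | ⟨m, hx, hy, hm⟩
    · rw [mem_stops, mem_stops, h]
    · rw [Equiv.symm_apply_apply] at hm
      rcases hi _ hm with h | h <;> refine absurd ?_ h <;> rw [mem_stops] <;> left <;> simpa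
  symm
  have hmin := (thresholdLabel_eq_iff θ σ x _).1 rfl
  refine (thresholdLabel_eq_iff θ σ y _).2 ⟨?_, fun i hi => ?_⟩
  · exact (key _ fun j hj => Or.inl (hmin.2 j hj)).1 hmin.1
  · rw [← key i fun j hj => Or.inl (hmin.2 j (hj.trans hi))]
    exact hmin.2 i hi

theorem shift_apply_left {x : Fin k → ℝ} {i j : Fin k} (hij : i ≠ j) (ε : ℝ) :
    shift x i j ε i = x i + ε := by
  simp [shift, hij]

theorem shift_apply_right {x : Fin k → ℝ} {i j : Fin k} (hij : i ≠ j) (ε : ℝ) :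
    shift x i j ε j = x j - ε := by
  simp [shift, hij.symm]

theorem shift_apply_of_ne {x : Fin k → ℝ} {i j l : Fin k} (hi : l ≠ i) (hj : l ≠ j) (ε : ℝ) :
    shift x i j ε l = x l := by
  simp [shift, hi, hj]

/-- A threshold scheme separates `x` from `x + ε 1_i - ε 1_j` only if the threshold of `i` or that
of `j` lies between the respective coordinates, and no earlier terminal takes both points. -/
theorem thresholdLabel_shift_ne [NeZero k] {θ : Fin k → ℝ} {σ : Equiv.Perm (Fin k)} {x : Fin k → ℝ}
    {i j : Fin k} (hij : i ≠ j) {ε : ℝ} (hε : 0 ≤ ε)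
    (h : thresholdLabel θ σ x ≠ thresholdLabel θ σ (shift x i j ε)) :
    (θ i ∈ Set.Ioc (x i) (x i + ε) ∧ (θ j ≤ x j - ε → σ.symm i < σ.symm j)) ∨
      (θ j ∈ Set.Ioc (x j - ε) (x j) ∧ (θ i ≤ x i → σ.symm j < σ.symm i)) := by
  by_contra hcon
  obtain ⟨h1, h2⟩ := not_or.1 hcon
  refine h (thresholdLabel_congr fun l => ?_)
  have hne : σ.symm i ≠ σ.symm j := fun e => hij (σ.symm.injective e)
  by_cases hli : l = i
  · subst hli
    rw [shift_apply_left hij]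
    by_cases hm : θ l ∈ Set.Ioc (x l) (x l + ε)
    · right
      have := not_and.1 h1 hm
      push Not at this
      exact ⟨j, by linarith, by rw [shift_apply_right hij]; exact this.1,
        lt_of_le_of_ne this.2 hne.symm⟩
    · left
      exact ⟨fun h => by linarith, fun h => not_lt.1 fun h' => hm ⟨h', h⟩⟩
  by_cases hlj : l = j
  · subst hlj
    rw [shift_apply_right hij]
    by_cases hm : θ l ∈ Set.Ioc (x l - ε) (x l)
    · right
      have := not_and.1 h2 hm
      push Not at this
      exact ⟨i, this.1, by rw [shift_apply_left hij]; linarith,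
        lt_of_le_of_ne this.2 hne⟩
    · left
      exact ⟨fun h => not_lt.1 fun h' => hm ⟨h', h⟩, fun h => by linarith⟩
  · left
    rw [shift_apply_of_ne hli hlj]

end ThresholdCut

/-! ### Cut probabilities of the threshold schemes -/

section ThresholdProbability

variable {k : ℕ}

theorem descendingOrder_symm_lt {θ : Fin k → ℝ} {i j : Fin k} (h : θ i < θ j) :
    (descendingOrder θ).symm j < (descendingOrder θ).symm i := by
  by_contra hcon
  have := descendingOrder_antitone θ (not_lt.1 hcon)
  simp only [Equiv.apply_symm_apply] at this
  linarith

instance isProbabilityMeasure_exponentialClocks [NeZero k] : IsProbabilityMeasure (exponentialClocks k) := by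
  have := ProbabilityTheory.isProbabilityMeasure_expMeasure one_pos
  exact Measure.isProbabilityMeasure_map measurable_clockLabel.aemeasurable

theorem isProbabilityMeasure_descendingThresholds [NeZero k] {ψ : ℝ → ℝ}
    [IsProbabilityMeasure (densityMeasure ψ)] :
    IsProbabilityMeasure (descendingThresholds k ψ) :=
  Measure.isProbabilityMeasure_map measurable_descendingLabel.aemeasurable

theorem singleThreshold_apply [NeZero k] {φ : ℝ → ℝ} {s : Set (Labeling k)} (hs : MeasurableSet s) :
    singleThreshold k φ s = (Fintype.card (Equiv.Perm (Fin k)) : ℝ≥0∞)⁻¹ *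
      ∑ σ : Equiv.Perm (Fin k),
        densityMeasure φ {θ | thresholdLabel (fun _ => θ) σ ∈ s} := by
  rw [singleThreshold, Measure.smul_apply, Measure.finsetSum_apply, smul_eq_mul]
  congr 1
  refine Finset.sum_congr rfl fun σ _ => ?_
  rw [Measure.map_apply (measurable_singleThresholdLabel σ) hs]
  rfl

theorem isProbabilityMeasure_singleThreshold [NeZero k] {φ : ℝ → ℝ}
    [IsProbabilityMeasure (densityMeasure φ)] :
    IsProbabilityMeasure (singleThreshold k φ) := by
  refine ⟨?_⟩
  rw [singleThreshold_apply MeasurableSet.univ]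
  simp only [Set.mem_univ, Set.ofPred_true, measure_univ, Finset.sum_const, Finset.card_univ,
    nsmul_eq_mul, mul_one]
  exact ENNReal.inv_mul_cancel (by simp [Fintype.card_ne_zero]) (by simp)

theorem singleThreshold_real_apply [NeZero k] {φ : ℝ → ℝ} [IsProbabilityMeasure (densityMeasure φ)]
    {s : Set (Labeling k)} (hs : MeasurableSet s) :
    (singleThreshold k φ).real s = (Fintype.card (Equiv.Perm (Fin k)) : ℝ)⁻¹ *
      ∑ σ : Equiv.Perm (Fin k),
        (densityMeasure φ).real {θ | thresholdLabel (fun _ => θ) σ ∈ s} := by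
  rw [measureReal_def, singleThreshold_apply hs, ENNReal.toReal_mul, ENNReal.toReal_inv,
    ENNReal.toReal_sum fun _ _ => measure_ne_top _ _]
  rfl

/-- Composing with the transposition of `i` and `j` exchanges the orders with `i` first and those
with `j` first, so each kind makes up half. -/
theorem sum_perm_symm_lt {i j : Fin k} (hij : i ≠ j) (A : ℝ) :
    ∑ σ : Equiv.Perm (Fin k), (if σ.symm i < σ.symm j then A else 0) =
      Fintype.card (Equiv.Perm (Fin k)) * (A / 2) := by
  have hswap : ∑ σ : Equiv.Perm (Fin k), (if σ.symm i < σ.symm j then A else 0) =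
      ∑ σ : Equiv.Perm (Fin k), (if σ.symm j < σ.symm i then A else 0) := by
    refine Fintype.sum_equiv (Equiv.mulLeft (Equiv.swap i j)) _ _ fun σ => ?_
    have h : ∀ l, (Equiv.swap i j * σ).symm l = σ.symm (Equiv.swap i j l) := fun l => by
      rw [Equiv.symm_apply_eq]
      simp
    simp only [Equiv.coe_mulLeft, h, Equiv.swap_apply_left, Equiv.swap_apply_right]
  have hadd : ∑ σ : Equiv.Perm (Fin k), (if σ.symm i < σ.symm j then A else 0) +
      ∑ σ : Equiv.Perm (Fin k), (if σ.symm j < σ.symm i then A else 0) =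
      Fintype.card (Equiv.Perm (Fin k)) * A := by
    rw [← Finset.sum_add_distrib, ← nsmul_eq_mul, ← Finset.card_univ, ← Finset.sum_const]
    refine Finset.sum_congr rfl fun σ _ => ?_
    have hne : σ.symm i ≠ σ.symm j := fun e => hij (σ.symm.injective e)
    rcases lt_or_gt_of_ne hne with h | h
    · simp [h, h.le]
    · simp [h, h.le]
  linarith

/-- Averaging over the orders: an event which costs `A` only in the orders with `i` before `j`, and
`B` in all orders. -/
theorem singleThreshold_real_le [NeZero k] {φ : ℝ → ℝ} [IsProbabilityMeasure (densityMeasure φ)]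
    {s : Set (Labeling k)} (hs : MeasurableSet s) {i j : Fin k} (hij : i ≠ j) {A B : ℝ}
    (h : ∀ σ : Equiv.Perm (Fin k),
      (densityMeasure φ).real {θ | thresholdLabel (fun _ => θ) σ ∈ s} ≤
        (if σ.symm i < σ.symm j then A else 0) + B) :
    (singleThreshold k φ).real s ≤ A / 2 + B := by
  have hN : (0 : ℝ) < Fintype.card (Equiv.Perm (Fin k)) := by exact_mod_cast Fintype.card_pos
  rw [singleThreshold_real_apply hs, inv_mul_le_iff₀ hN]
  refine (Finset.sum_le_sum fun σ _ => h σ).trans (le_of_eq ?_)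
  rw [Finset.sum_add_distrib, sum_perm_symm_lt hij, Finset.sum_const, Finset.card_univ,
    nsmul_eq_mul]
  ring

/-- A threshold in `(x j - ε, x j]` is passed by coordinate `i` at both endpoints, so it cuts only
in the half of the orders where `j` precedes `i`. -/
theorem singleThreshold_cut_le_of_le [NeZero k] {φ : ℝ → ℝ} [IsProbabilityMeasure (densityMeasure φ)]
    {x : Fin k → ℝ} {i j : Fin k} (hij : i ≠ j) {ε : ℝ} (hε : 0 ≤ ε) (hle : x j ≤ x i) :
    (singleThreshold k φ).real {ℓ | ℓ x ≠ ℓ (shift x i j ε)} ≤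
      (densityMeasure φ).real (Set.Ioc (x j - ε) (x j)) / 2 +
        (densityMeasure φ).real (Set.Ioc (x i) (x i + ε)) := by
  refine singleThreshold_real_le (measurableSet_label_ne _ _) hij.symm fun σ => ?_
  split_ifs with hσ
  · refine (measureReal_mono fun θ hθ => ?_).trans (measureReal_union_le _ _)
    rcases thresholdLabel_shift_ne hij hε hθ with h | h
    · exact Or.inr h.1
    · exact Or.inl h.1
  · rw [zero_add]
    refine measureReal_mono fun θ hθ => ?_
    rcases thresholdLabel_shift_ne hij hε hθ with h | h
    · exact h.1
    · exact absurd (h.2 (h.1.2.trans hle)) hσ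

/-- The mirror case. The gap `x i + ε ≤ x j - ε` ensures that coordinate `j` passes a threshold in
`(x i, x i + ε]` even after losing `ε`. -/
theorem singleThreshold_cut_le_of_lt [NeZero k] {φ : ℝ → ℝ} [IsProbabilityMeasure (densityMeasure φ)]
    {x : Fin k → ℝ} {i j : Fin k} (hij : i ≠ j) {ε : ℝ} (hε : 0 ≤ ε)
    (hle : x i + ε ≤ x j - ε) :
    (singleThreshold k φ).real {ℓ | ℓ x ≠ ℓ (shift x i j ε)} ≤
      (densityMeasure φ).real (Set.Ioc (x i) (x i + ε)) / 2 +
        (densityMeasure φ).real (Set.Ioc (x j - ε) (x j)) := by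
  refine singleThreshold_real_le (measurableSet_label_ne _ _) hij fun σ => ?_
  split_ifs with hσ
  · refine (measureReal_mono fun θ hθ => ?_).trans (measureReal_union_le _ _)
    rcases thresholdLabel_shift_ne hij hε hθ with h | h
    · exact Or.inl h.1
    · exact Or.inr h.1
  · rw [zero_add]
    refine measureReal_mono fun θ hθ => ?_
    rcases thresholdLabel_shift_ne hij hε hθ with h | h
    · exact absurd (h.2 (h.1.2.trans hle)) hσ
    · exact h.1

theorem pi_real_and {ν : Measure ℝ} [IsProbabilityMeasure ν] {i j : Fin k} (hij : i ≠ j)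
    (A B : Set ℝ) :
    (Measure.pi fun _ : Fin k => ν).real {θ | θ i ∈ A ∧ θ j ∈ B} = ν.real A * ν.real B := by
  have : {θ : Fin k → ℝ | θ i ∈ A ∧ θ j ∈ B} =
      Set.univ.pi fun l => if l = i then A else if l = j then B else Set.univ := by
    ext θ
    simp only [Set.mem_ofPred_eq, Set.mem_univ_pi]
    constructor
    · rintro ⟨h1, h2⟩ l
      split_ifs with h h'
      · exact h ▸ h1
      · exact h' ▸ h2
      · trivial
    · intro h
      exact ⟨by simpa using h i, by simpa [hij.symm] using h j⟩
  rw [this, measureReal_def, Measure.pi_pi, ENNReal.toReal_prod, ← Finset.mul_prod_erase _ _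
    (Finset.mem_univ i), ← Finset.mul_prod_erase _ _
    (Finset.mem_erase.2 ⟨hij.symm, Finset.mem_univ j⟩), Finset.prod_eq_one]
  · simp [hij.symm, measureReal_def]
  · intro l hl
    simp only [Finset.mem_erase] at hl
    simp [hl.1, hl.2.1]

theorem pi_real_eval {ν : Measure ℝ} [IsProbabilityMeasure ν] (i : Fin k) {A : Set ℝ}
    (hA : MeasurableSet A) :
    (Measure.pi fun _ : Fin k => ν).real {θ | θ i ∈ A} = ν.real A := by
  exact (measurePreserving_eval (fun _ : Fin k => ν) i).measureReal_preimage
    hA.nullMeasurableSet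

theorem descendingThresholds_real_apply [NeZero k] {ψ : ℝ → ℝ} {s : Set (Labeling k)}
    (hs : MeasurableSet s) :
    (descendingThresholds k ψ).real s = (Measure.pi fun _ : Fin k => densityMeasure ψ).real
      {θ | thresholdLabel θ (descendingOrder θ) ∈ s} := by
  rw [measureReal_def, descendingThresholds, Measure.map_apply measurable_descendingLabel hs]
  rfl

/-- If `θ i` lies in `(x j, x i]`, it exceeds any `θ j ≤ x j`, so `i` comes first and takes both
endpoints; independence gives the product. For `x i < x j` the interval is empty and this is a plain
union bound, which `cut_le_const_mul` also uses. -/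
theorem descendingThresholds_cut_le_of_le [NeZero k] {ψ : ℝ → ℝ} [IsProbabilityMeasure (densityMeasure ψ)]
    {x : Fin k → ℝ} {i j : Fin k} (hij : i ≠ j) {ε : ℝ} (hε : 0 ≤ ε) :
    (descendingThresholds k ψ).real {ℓ | ℓ x ≠ ℓ (shift x i j ε)} ≤
      (densityMeasure ψ).real (Set.Ioc (x j - ε) (x j)) *
          (1 - (densityMeasure ψ).real (Set.Ioc (x j) (x i))) +
        (densityMeasure ψ).real (Set.Ioc (x i) (x i + ε)) := by
  rw [descendingThresholds_real_apply (measurableSet_label_ne _ _),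
    ← probReal_compl_eq_one_sub measurableSet_Ioc, ← pi_real_and hij.symm,
    ← pi_real_eval i measurableSet_Ioc]
  refine (measureReal_mono fun θ hθ => ?_).trans (measureReal_union_le _ _)
  rcases thresholdLabel_shift_ne hij hε hθ with h | h
  · exact Or.inr h.1
  · refine Or.inl ⟨h.1, fun h' => ?_⟩
    exact lt_asymm (h.2 h'.2) (descendingOrder_symm_lt (h.1.2.trans_lt h'.1))

/-- The interval for `θ j` is shrunk at both ends: `θ j` must exceed every `θ i ≤ x i + ε` and still
be passed by `x j - ε`. -/
theorem descendingThresholds_cut_le_of_lt [NeZero k] {ψ : ℝ → ℝ} [IsProbabilityMeasure (densityMeasure ψ)]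
    {x : Fin k → ℝ} {i j : Fin k} (hij : i ≠ j) {ε : ℝ} (hε : 0 ≤ ε) :
    (descendingThresholds k ψ).real {ℓ | ℓ x ≠ ℓ (shift x i j ε)} ≤
      (densityMeasure ψ).real (Set.Ioc (x i) (x i + ε)) *
          (1 - (densityMeasure ψ).real (Set.Ioc (x i + ε) (x j - ε))) +
        (densityMeasure ψ).real (Set.Ioc (x j - ε) (x j)) := by
  rw [descendingThresholds_real_apply (measurableSet_label_ne _ _),
    ← probReal_compl_eq_one_sub measurableSet_Ioc, ← pi_real_and hij,
    ← pi_real_eval j measurableSet_Ioc]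
  refine (measureReal_mono fun θ hθ => ?_).trans (measureReal_union_le _ _)
  rcases thresholdLabel_shift_ne hij hε hθ with h | h
  · refine Or.inl ⟨h.1, fun h' => ?_⟩
    exact lt_asymm (h.2 h'.2) (descendingOrder_symm_lt (h.1.2.trans_lt h'.1))
  · exact Or.inr h.1

end ThresholdProbability

/-! ### Races of exponential clocks -/

section Race

open ProbabilityTheory

theorem expMeasure_Ioi {t : ℝ} (ht : 0 ≤ t) :
    expMeasure 1 (Set.Ioi t) = ENNReal.ofReal (Real.exp (-t)) := by
  have := isProbabilityMeasure_expMeasure one_pos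
  rw [← ofReal_measureReal, ← Set.compl_Iic, probReal_compl_eq_one_sub measurableSet_Iic,
    ← cdf_eq_real, cdf_expMeasure_eq one_pos, if_pos ht]
  simp

theorem expMeasure_eq_withDensity :
    expMeasure 1 = volume.withDensity (exponentialPDF 1) := rfl

/-- Given that one clock rings at time `z`, the integrand is the probability that it wins a race in
which the factors of the others sum to `C`. -/
theorem lintegral_exp_neg_mul_expMeasure {C : ℝ} (hC : 0 ≤ C) :
    ∫⁻ z in Set.Ioi 0, ENNReal.ofReal (Real.exp (-(C * z))) ∂(expMeasure 1) =
      ENNReal.ofReal (1 / (1 + C)) := by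
  have hpdf : Measurable (exponentialPDF 1) :=
    (measurable_exponentialPDFReal 1).ennreal_ofReal
  rw [expMeasure_eq_withDensity, setLIntegral_withDensity_eq_setLIntegral_mul _ hpdf
    (by fun_prop) measurableSet_Ioi]
  have h1 : ∫⁻ z in Set.Ioi (0 : ℝ),
      (exponentialPDF 1 * fun z => ENNReal.ofReal (Real.exp (-(C * z)))) z =
      ∫⁻ z in Set.Ioi (0 : ℝ), ENNReal.ofReal (Real.exp (-(1 + C) * z)) := by
    refine setLIntegral_congr_fun measurableSet_Ioi fun z hz => ?_
    simp only [Pi.mul_apply]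
    rw [exponentialPDF_of_nonneg (le_of_lt hz), ← ENNReal.ofReal_mul (by positivity), one_mul,
      ← Real.exp_add]
    congr 2
    ring
  rw [h1, ← ofReal_integral_eq_lintegral_ofReal (integrableOn_exp_mul_Ioi (by linarith) 0)
    (ae_of_all _ fun _ => (Real.exp_pos _).le), integral_exp_mul_Ioi (by linarith)]
  congr 1
  rw [mul_zero, Real.exp_zero, neg_div_neg_eq]

/-- The clock `l` rings first, even when the other clocks `m` are sped up by factors `1 / c m`,
with probability `1 / (1 + ∑ c m)`. -/
theorem expMeasure_pi_race {n : ℕ} (l : Fin (n + 1)) {c : Fin (n + 1) → ℝ} (hc : ∀ m, 0 ≤ c m) :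
    (Measure.pi fun _ : Fin (n + 1) => expMeasure 1)
      {Z | 0 < Z l ∧ ∀ m, m ≠ l → c m * Z l < Z m} =
      ENNReal.ofReal (1 / (1 + ∑ m : Fin n, c (l.succAbove m))) := by
  have := isProbabilityMeasure_expMeasure one_pos
  have hmp := measurePreserving_piFinSuccAbove (fun _ : Fin (n + 1) => expMeasure 1) l
  let S : Set (ℝ × (Fin n → ℝ)) := {p | 0 < p.1 ∧ ∀ m, c (l.succAbove m) * p.1 < p.2 m}
  have hS : MeasurableSet S := by
    refine MeasurableSet.inter (measurableSet_lt measurable_const measurable_fst)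
      (measurableSet_forall fun m => ?_)
    exact measurableSet_lt (by fun_prop) (by fun_prop)
  have hpre : {Z : Fin (n + 1) → ℝ | 0 < Z l ∧ ∀ m, m ≠ l → c m * Z l < Z m} =
      MeasurableEquiv.piFinSuccAbove (fun _ : Fin (n + 1) => ℝ) l ⁻¹' S := by
    ext Z
    refine and_congr_right fun _ => ⟨fun h m => h _ (Fin.succAbove_ne l m), fun h m hm => ?_⟩
    obtain ⟨m, rfl⟩ := Fin.exists_succAbove_eq hm
    exact h m
  rw [hpre, hmp.measure_preimage hS.nullMeasurableSet, Measure.prod_apply hS,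
    ← lintegral_exp_neg_mul_expMeasure (Finset.sum_nonneg fun _ _ => hc _),
    ← lintegral_indicator measurableSet_Ioi]
  refine lintegral_congr fun z => ?_
  by_cases hz : 0 < z
  · have hsec : Prod.mk z ⁻¹' S = Set.univ.pi fun m => Set.Ioi (c (l.succAbove m) * z) := by
      ext w
      simp [S, hz]
    rw [hsec, Measure.pi_pi, Set.indicator_of_mem (Set.mem_Ioi.2 hz)]
    simp only [expMeasure_Ioi (mul_nonneg (hc _) hz.le)]
    rw [← ENNReal.ofReal_prod_of_nonneg fun _ _ => (Real.exp_pos _).le, ← Real.exp_sum,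
      Finset.sum_neg_distrib, Finset.sum_mul]
  · have hsec : Prod.mk z ⁻¹' S = ∅ := by
      ext w
      simp [S, hz]
    rw [hsec, measure_empty, Set.indicator_of_notMem (fun h => hz (Set.mem_Ioi.1 h))]

theorem ae_pos_expMeasure_pi (k : ℕ) :
    ∀ᵐ Z ∂(Measure.pi fun _ : Fin k => expMeasure 1), ∀ i, 0 < Z i := by
  have := isProbabilityMeasure_expMeasure one_pos
  refine ae_all_iff.2 fun i => ?_
  have h : ∀ᵐ z ∂(expMeasure 1), 0 < z := by
    rw [ae_iff]
    have : {z : ℝ | ¬ 0 < z} = (Set.Ioi 0)ᶜ := by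
      ext z
      simp
    rw [this, prob_compl_eq_zero_iff measurableSet_Ioi, expMeasure_Ioi le_rfl]
    simp
  exact (measurePreserving_eval (fun _ : Fin k => expMeasure 1) i).quasiMeasurePreserving.ae h

end Race

/-! ### Cut probability of the exponential clocks -/

section ClockProbability

open ProbabilityTheory

variable {k : ℕ}

theorem clockLabel_eq_of_lt [NeZero k] {Z x : Fin k → ℝ} {l : Fin k}
    (h : ∀ m, m ≠ l → clockRatio Z x l < clockRatio Z x m) : clockLabel Z x = l := by
  refine (clockLabel_eq_iff Z x l).2 ⟨fun j => ?_, fun m hm hle => ?_⟩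
  · by_cases hj : j = l
    · rw [hj]
    · exact (h j hj).le
  · exact (h m hm.ne).not_ge (hle l)

theorem clockRatio_lt {Z x : Fin k → ℝ} {l m : Fin k} {c : ℝ} (hl : 0 < x l) (hZ : 0 ≤ Z l)
    (hc : 0 ≤ c) (hx : x m ≤ c * x l) (h : c * Z l < Z m) :
    clockRatio Z x l < clockRatio Z x m := by
  have hZm : 0 < Z m := (mul_nonneg hc hZ).trans_lt h
  unfold clockRatio
  rw [← ENNReal.ofReal_div_of_pos hl]
  rcases le_or_gt (x m) 0 with hm | hm
  · rw [ENNReal.ofReal_of_nonpos hm, ENNReal.div_zero (by simpa using hZm)]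
    exact ENNReal.ofReal_lt_top
  · rw [← ENNReal.ofReal_div_of_pos hm, ENNReal.ofReal_lt_ofReal_iff (div_pos hZm hm),
      div_lt_div_iff₀ hl hm]
    nlinarith

/-- A factor `c m` bounding both `x m / x l` and `y m / y l` lets a single race event force the
label `l` at both points. -/
theorem exponentialClocks_real_both_ge [NeZero k] {x y c : Fin k → ℝ} {l : Fin k} (hx : 0 < x l)
    (hy : 0 < y l) (hc : ∀ m, 0 ≤ c m) (hcx : ∀ m, m ≠ l → x m ≤ c m * x l)
    (hcy : ∀ m, m ≠ l → y m ≤ c m * y l) :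
    1 / (1 + (∑ m, c m - c l)) ≤ (exponentialClocks k).real {ℓ | ℓ x = l ∧ ℓ y = l} := by
  have := isProbabilityMeasure_expMeasure one_pos
  obtain ⟨n, rfl⟩ : ∃ n, k = n + 1 := Nat.exists_eq_succ_of_ne_zero (NeZero.ne k)
  have hs : MeasurableSet {ℓ : Labeling (n + 1) | ℓ x = l ∧ ℓ y = l} :=
    (measurableSet_label_eq x l).inter (measurableSet_label_eq y l)
  rw [measureReal_def, exponentialClocks, Measure.map_apply measurable_clockLabel hs,
    Fin.sum_univ_succAbove c l, add_sub_cancel_left, ← ENNReal.ofReal_le_iff_le_toReal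
    (measure_ne_top _ _), ← expMeasure_pi_race l hc]
  refine measure_mono fun Z hZ => ?_
  exact ⟨clockLabel_eq_of_lt fun m hm => clockRatio_lt hx hZ.1.le (hc m) (hcx m hm) (hZ.2 m hm),
    clockLabel_eq_of_lt fun m hm => clockRatio_lt hy hZ.1.le (hc m) (hcy m hm) (hZ.2 m hm)⟩

theorem exponentialClocks_cut_le [NeZero k] {x : Fin k → ℝ} {i j : Fin k} (hij : i ≠ j) {ε : ℝ}
    (hε : 0 ≤ ε) (hx : x ∈ stdSimplex ℝ (Fin k)) (hy : shift x i j ε ∈ stdSimplex ℝ (Fin k)) :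
    (exponentialClocks k).real {ℓ | ℓ x ≠ ℓ (shift x i j ε)} ≤ ε * (2 - x i - x j) := by
  set y := shift x i j ε with hydef
  have hyi : y i = x i + ε := shift_apply_left hij ε
  have hyj : y j = x j - ε := shift_apply_right hij ε
  have hyl : ∀ l, l ≠ i → l ≠ j → y l = x l := fun l hi hj => shift_apply_of_ne hi hj ε
  obtain ⟨hx0, hx1⟩ := hx
  obtain ⟨hy0, hy1⟩ := hy
  -- The winning probabilities of the races with `c m = max (x m / x l) (y m / y l)`. The maximum is
  -- attained at `x` for `l = i` and at `y` for `l = j`; for other `l` the numerators add up to `1 +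
  -- ε`, the excess coming from `m = i`.
  let q : Fin k → ℝ := fun l => if l = i then x i else if l = j then y j else x l / (1 + ε)
  have hq : ∀ l, q l ≤ (exponentialClocks k).real {ℓ | ℓ x = l ∧ ℓ y = l} := by
    intro l
    by_cases hli : l = i
    · subst hli
      simp only [q, if_true]
      rcases (hx0 l).eq_or_lt with h0 | h0
      · rw [← h0]
        exact measureReal_nonneg
      · refine le_trans (le_of_eq ?_) (exponentialClocks_real_both_ge (c := fun m => x m / x l) h0
          (by rw [hyi]; linarith) (fun m => div_nonneg (hx0 m) h0.le)
          (fun m _ => (div_mul_cancel₀ _ h0.ne').ge) fun m hm => ?_)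
        · rw [← Finset.sum_div, hx1]
          field_simp
          ring
        · have hm' : y m ≤ x m := by
            by_cases hmj : m = j
            · rw [hmj, hyj]
              linarith
            · rw [hyl m hm hmj]
          rw [hyi, div_mul_eq_mul_div, le_div_iff₀ h0]
          nlinarith [hx0 m]
    · by_cases hlj : l = j
      · subst hlj
        simp only [q, if_true, hli, if_false]
        rcases (hy0 l).eq_or_lt with h0 | h0
        · rw [← h0]
          exact measureReal_nonneg
        · refine le_trans (le_of_eq ?_) (exponentialClocks_real_both_ge (c := fun m => y m / y l)
            (by linarith) h0 (fun m => div_nonneg (hy0 m) h0.le)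
            (fun m hm => ?_) (fun m _ => (div_mul_cancel₀ _ h0.ne').ge))
          · rw [← Finset.sum_div, hy1]
            field_simp
            ring
          · have hm' : x m ≤ y m := by
              by_cases hmi : m = i
              · rw [hmi, hyi]
                linarith
              · rw [hyl m hmi hm]
            rw [div_mul_eq_mul_div, le_div_iff₀ h0]
            nlinarith [hy0 m]
      · simp only [q, hli, hlj, if_false]
        rcases (hx0 l).eq_or_lt with h0 | h0
        · rw [← h0, zero_div]
          exact measureReal_nonneg
        · have hyl' := hyl l hli hlj
          refine le_trans (le_of_eq ?_) (exponentialClocks_real_both_ge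
            (c := fun m => (x m + if m = i then ε else 0) / x l) h0 (by linarith)
            (fun m => div_nonneg (add_nonneg (hx0 m) (by split_ifs <;> simp [hε])) h0.le)
            (fun m hm => ?_) (fun m hm => ?_))
          · rw [← Finset.sum_div, Finset.sum_add_distrib, hx1]
            simp only [Finset.sum_ite_eq', Finset.mem_univ, if_true, hli, if_false, add_zero]
            rw [div_self h0.ne', add_sub_cancel, one_div_div]
          · rw [div_mul_cancel₀ _ h0.ne']
            split_ifs <;> linarith
          · rw [hyl', div_mul_cancel₀ _ h0.ne']
            split_ifs with hmi
            · rw [hmi, hyi]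
            · by_cases hmj : m = j
              · rw [hmj, hyj]
                linarith
              · rw [hyl m hmi hmj, add_zero]
  have hsum : ∑ l, (exponentialClocks k).real {ℓ | ℓ x = l ∧ ℓ y = l} =
      (exponentialClocks k).real {ℓ | ℓ x = ℓ y} := by
    rw [← measureReal_iUnion_fintype]
    · congr 1
      ext ℓ
      simp [eq_comm]
    · intro l m hlm
      refine Set.disjoint_left.2 fun ℓ h1 h2 => hlm (h1.1.symm.trans h2.1)
    · exact fun l => (measurableSet_label_eq x l).inter (measurableSet_label_eq y l)
  have hcompl : (exponentialClocks k).real {ℓ | ℓ x ≠ ℓ y} =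
      1 - (exponentialClocks k).real {ℓ | ℓ x = ℓ y} := by
    rw [← probReal_compl_eq_one_sub
      (measurableSet_eq_fun (measurable_pi_apply x) (measurable_pi_apply y))]
    rfl
  have hqsum : ∑ l, q l = (1 - x i - x j) / (1 + ε) + x i + y j := by
    have h1 : ∑ l, x l / (1 + ε) = 1 / (1 + ε) := by rw [← Finset.sum_div, hx1]
    have h2 : ∑ l, (q l - x l / (1 + ε)) = (x i - x i / (1 + ε)) + (y j - x j / (1 + ε)) := by
      rw [Finset.sum_eq_add i j hij]
      · simp [q, hij.symm]
      · intro l _ hl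
        simp [q, hl.1, hl.2]
      · simp
      · simp
    rw [Finset.sum_sub_distrib, h1] at h2
    have : ∑ l, q l = (x i - x i / (1 + ε)) + (y j - x j / (1 + ε)) + 1 / (1 + ε) := by linarith
    rw [this]
    ring
  have hle := Finset.sum_le_sum fun l (_ : l ∈ Finset.univ) => hq l
  rw [hsum, hqsum] at hle
  have hs : 0 ≤ 1 - x i - x j := by
    rw [← hx1, ← Finset.add_sum_erase _ _ (Finset.mem_univ i),
      ← Finset.add_sum_erase _ _ (Finset.mem_erase.2 ⟨hij.symm, Finset.mem_univ j⟩)]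
    have := Finset.sum_nonneg fun l (_ : l ∈ (Finset.univ.erase i).erase j) => hx0 l
    linarith
  -- From `1 / (1 + ε) ≥ 1 - ε`; this makes the bound linear in `ε` with no error term.
  have hfrac : (1 - x i - x j) * (1 - ε) ≤ (1 - x i - x j) / (1 + ε) := by
    rw [le_div_iff₀ (by linarith)]
    nlinarith [mul_nonneg hs (sq_nonneg ε)]
  rw [hcompl]
  rw [hyj] at hle
  linarith

end ClockProbability

/-! ### Measures with density -/

section Density

theorem densityMeasure_real_Ioc_le {f : ℝ → ℝ} {s t M : ℝ} (hst : s ≤ t) (hM : 0 ≤ M)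
    (h : ∀ u ∈ Set.Ioc s t, f u ≤ M) :
    (densityMeasure f).real (Set.Ioc s t) ≤ M * (t - s) := by
  rw [measureReal_def, densityMeasure, withDensity_apply _ measurableSet_Ioc]
  refine ENNReal.toReal_le_of_le_ofReal (mul_nonneg hM (sub_nonneg.2 hst)) ?_
  calc ∫⁻ u in Set.Ioc s t, ENNReal.ofReal (f u)
      ≤ ∫⁻ _ in Set.Ioc s t, ENNReal.ofReal M :=
        setLIntegral_mono' measurableSet_Ioc fun u hu => ENNReal.ofReal_le_ofReal (h u hu)
    _ = ENNReal.ofReal (M * (t - s)) := by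
        rw [setLIntegral_const, Real.volume_Ioc, ENNReal.ofReal_mul hM]

theorem le_densityMeasure_real_Ioc {f : ℝ → ℝ} [IsFiniteMeasure (densityMeasure f)] {s t m : ℝ}
    (hm : 0 ≤ m) (h : ∀ u ∈ Set.Ioc s t, m ≤ f u) :
    m * (t - s) ≤ (densityMeasure f).real (Set.Ioc s t) := by
  rw [measureReal_def, ← ENNReal.ofReal_le_iff_le_toReal (measure_ne_top _ _), densityMeasure,
    withDensity_apply _ measurableSet_Ioc]
  calc ENNReal.ofReal (m * (t - s)) = ∫⁻ _ in Set.Ioc s t, ENNReal.ofReal m := by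
        rw [setLIntegral_const, Real.volume_Ioc, ENNReal.ofReal_mul hm]
    _ ≤ ∫⁻ u in Set.Ioc s t, ENNReal.ofReal (f u) :=
        setLIntegral_mono' measurableSet_Ioc fun u hu => ENNReal.ofReal_le_ofReal (h u hu)

theorem isProbabilityMeasure_densityMeasure {f : ℝ → ℝ} (hf : Integrable f) (h0 : ∀ u, 0 ≤ f u)
    (h1 : ∫ u, f u = 1) : IsProbabilityMeasure (densityMeasure f) := by
  refine ⟨?_⟩
  rw [densityMeasure, withDensity_apply _ MeasurableSet.univ, Measure.restrict_univ,
    ← ofReal_integral_eq_lintegral_ofReal hf (ae_of_all _ h0), h1, ENNReal.ofReal_one]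

theorem ae_densityMeasure {f : ℝ → ℝ} (hf : Measurable f) {p : ℝ → Prop}
    (h : ∀ᵐ u, f u ≠ 0 → p u) : ∀ᵐ u ∂(densityMeasure f), p u := by
  rw [densityMeasure, ae_withDensity_iff hf.ennreal_ofReal]
  filter_upwards [h] with u hu hne
  exact hu fun h0 => hne (by rw [h0, ENNReal.ofReal_zero])

end Density

/-! ### The parameters of the combined scheme -/

/-- The values of the parameters for which the cut densities are balanced. -/
structure IsBalanced (p₁ p₂ p₃ a b c d : ℝ) : Prop where
  p₁_eq : p₁ = (6 + 5 * √3) / 26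
  p₂_eq : p₂ = (19 - 8 * √3) / 13
  p₃_eq : p₃ = (11 * √3 - 18) / 26
  b_eq : b = 2 * √3 - 3
  mul_a_eq : p₂ * a = (12 + 10 * √3) / 39
  mul_c_eq : p₂ * c = (6 + 5 * √3) / 26
  mul_d_eq : p₂ * d = (4 - √3) / 13

theorem sqrt_three_bounds : 1.732 < √3 ∧ √3 < 1.7321 := by
  constructor
  · exact Real.lt_sqrt_of_sq_lt (by norm_num)
  · rw [Real.sqrt_lt' (by norm_num)]
    norm_num

theorem sqrt_three_sq : √3 ^ 2 = 3 := Real.sq_sqrt (by norm_num)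

namespace IsBalanced

variable {p₁ p₂ p₃ a b c d : ℝ} (h : IsBalanced p₁ p₂ p₃ a b c d)
include h

theorem p₁_pos : 0 < p₁ := by
  rw [h.p₁_eq]
  positivity

theorem p₂_pos : 0 < p₂ := by
  rw [h.p₂_eq]
  linarith [sqrt_three_bounds.2]

theorem p₃_pos : 0 < p₃ := by
  rw [h.p₃_eq]
  linarith [sqrt_three_bounds.1]

theorem sum_eq_one : p₁ + p₂ + p₃ = 1 := by
  rw [h.p₁_eq, h.p₂_eq, h.p₃_eq]
  ring

theorem b_pos : 0 < b := by
  rw [h.b_eq]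
  linarith [sqrt_three_bounds.1]

theorem b_lt_one : b < 1 := by
  rw [h.b_eq]
  linarith [sqrt_three_bounds.2]

theorem a_eq : a = (36 + 22 * √3) / 39 := by
  refine mul_left_cancel₀ h.p₂_pos.ne' ?_
  rw [h.mul_a_eq, h.p₂_eq]
  linear_combination (176 / 507) * sqrt_three_sq

theorem c_eq : c = (18 + 11 * √3) / 26 := by
  refine mul_left_cancel₀ h.p₂_pos.ne' ?_
  rw [h.mul_c_eq, h.p₂_eq]
  linear_combination (88 / 338) * sqrt_three_sq

theorem d_eq : d = (4 + √3) / 13 := by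
  refine mul_left_cancel₀ h.p₂_pos.ne' ?_
  rw [h.mul_d_eq, h.p₂_eq]
  linear_combination (8 / 169) * sqrt_three_sq

theorem one_div_b_eq : 1 / b = (2 * √3 + 3) / 3 := by
  rw [div_eq_iff h.b_pos.ne', h.b_eq]
  linear_combination (-4 / 3) * sqrt_three_sq

theorem a_pos : 0 < a := by
  rw [h.a_eq]
  positivity

theorem c_pos : 0 < c := by
  rw [h.c_eq]
  positivity

theorem d_pos : 0 < d := by
  rw [h.d_eq]
  positivity

/-- Here `s ≤ t ≤ b` are the two coordinates. Since `p₂ a = 4 p₁ / 3` and `p₃ / b² = p₁ / 3`, the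
coefficients of `s` and `t` vanish, leaving `2 p₁ + 2 p₃ / b`. -/
theorem density_low_low (s t : ℝ) :
    p₁ * (2 - s - t) + p₂ * (a * s / 2 + a * t) +
      p₃ * (1 / b * (1 - 1 / b * (t - s)) + 1 / b) = (10 + 4 * √3) / 13 := by
  rw [h.one_div_b_eq, h.a_eq, h.p₁_eq, h.p₂_eq, h.p₃_eq]
  have h3 : √3 ^ 3 = 3 * √3 := by rw [pow_succ, sqrt_three_sq]
  ring_nf
  rw [h3, sqrt_three_sq]
  ring

/-- Here `s ≤ b < t`, so `ψ` vanishes at `t` and only its mass on `(s, b]` counts. The coefficient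
of `s` vanishes as before and that of `t` because `p₂ c = p₁`, leaving `2 p₁ + p₂ d`. -/
theorem density_low_high (s t : ℝ) :
    p₁ * (2 - s - t) + p₂ * (a * s / 2 + (c * t + d)) +
      p₃ * (1 / b * (1 - 1 / b * (b - s))) = (10 + 4 * √3) / 13 := by
  have h1 : 1 / b * (1 - 1 / b * (b - s)) = 1 / b * (1 / b) * s := by
    have := h.b_pos.ne'
    field_simp
    ring
  rw [h1, h.one_div_b_eq, h.a_eq, h.c_eq, h.d_eq, h.p₁_eq, h.p₂_eq, h.p₃_eq]
  have h3 : √3 ^ 3 = 3 * √3 := by rw [pow_succ, sqrt_three_sq]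
  ring_nf
  rw [h3, sqrt_three_sq]
  ring

/-- The only case with slack. As `p₂ c = p₁`, the left side is `2 p₁ - p₁ s / 2 + 3 p₂ d / 2`, which
is at most `2 p₁ + p₂ d` because `p₂ d = 2 p₁ b / 3 ≤ p₁ s`. -/
theorem density_high_high {s : ℝ} (t : ℝ) (hs : b ≤ s) :
    p₁ * (2 - s - t) + p₂ * ((c * s + d) / 2 + (c * t + d)) ≤ (10 + 4 * √3) / 13 := by
  have h1 : p₁ * (2 - s - t) + p₂ * ((c * s + d) / 2 + (c * t + d)) =
      p₁ * (2 - s - t) + (p₂ * c) * (s / 2 + t) + 3 / 2 * (p₂ * d) := by ring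
  have h2 : (6 + 5 * √3) / 26 * b ≤ (6 + 5 * √3) / 26 * s :=
    mul_le_mul_of_nonneg_left hs (by positivity)
  rw [h.b_eq] at h2
  rw [h1, h.mul_c_eq, h.mul_d_eq, h.p₁_eq]
  nlinarith [sqrt_three_sq, sqrt_three_bounds.1, sqrt_three_bounds.2]

/-! ### Pointwise bounds and normalization of the two densities. -/

theorem phi_nonneg (u : ℝ) : 0 ≤ phi a b c d u := by
  have ha := h.a_pos
  have hb := h.b_pos
  have hc := h.c_pos
  have hd := h.d_pos
  unfold phi
  split_ifs with h1 h2
  · exact mul_nonneg ha.le h1.1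
  · have : 0 ≤ u := by linarith [h2.1]
    positivity
  · exact le_rfl

theorem psi_nonneg (u : ℝ) : 0 ≤ psi b u := by
  have := h.b_pos
  unfold psi
  split_ifs <;> positivity

theorem phi_le_of_le {s u : ℝ} (hs : 0 ≤ s) (hsb : s ≤ b) (hu : u ≤ s) :
    phi a b c d u ≤ a * s := by
  have ha := h.a_pos
  unfold phi
  split_ifs with h1 h2
  · exact mul_le_mul_of_nonneg_left hu ha.le
  · linarith [h2.1]
  · positivity

theorem phi_le_of_lt {s u : ℝ} (hbu : b < u) (hu : u ≤ s) : phi a b c d u ≤ c * s + d := by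
  have hb := h.b_pos
  have hc := h.c_pos
  have hd := h.d_pos
  unfold phi
  split_ifs with h1 h2
  · linarith [h1.2]
  · have := mul_le_mul_of_nonneg_left hu hc.le
    linarith
  · have : 0 ≤ s := by linarith
    positivity

theorem phi_le (u : ℝ) : phi a b c d u ≤ a + c + d := by
  have ha := h.a_pos
  have hc := h.c_pos
  have hd := h.d_pos
  unfold phi
  split_ifs with h1 h2
  · nlinarith [h.b_lt_one]
  · nlinarith
  · positivity

theorem psi_le (u : ℝ) : psi b u ≤ 1 / b := by
  have := h.b_pos
  unfold psi
  split_ifs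
  · exact le_rfl
  · positivity

omit h in
theorem psi_of_lt {u : ℝ} (hu : b < u) : psi b u = 0 := by
  unfold psi
  rw [if_neg fun h => hu.not_ge h.2]

omit h in
theorem psi_of_mem {u : ℝ} (h0 : 0 ≤ u) (hu : u ≤ b) : psi b u = 1 / b := by
  unfold psi
  rw [if_pos ⟨h0, hu⟩]

omit h in
theorem phi_eq_indicator : phi a b c d = fun u =>
    (Set.Icc 0 b).indicator (fun u => a * u) u + (Set.Ioc b 1).indicator (fun u => c * u + d) u := by
  funext u
  unfold phi
  by_cases h1 : 0 ≤ u ∧ u ≤ b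
  · have h2 : u ∉ Set.Ioc b 1 := fun h => h.1.not_ge h1.2
    rw [if_pos h1, Set.indicator_of_mem (Set.mem_Icc.2 h1), Set.indicator_of_notMem h2, add_zero]
  · rw [if_neg h1, Set.indicator_of_notMem (fun h => h1 (Set.mem_Icc.1 h)), zero_add]
    simp only [Set.indicator_apply, Set.mem_Ioc]

omit h in
theorem psi_eq_indicator : psi b = (Set.Icc 0 b).indicator fun _ => 1 / b := by
  funext u
  simp only [psi, Set.indicator_apply, Set.mem_Icc]

omit h in
theorem measurable_phi : Measurable (phi a b c d) := by
  rw [phi_eq_indicator]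
  exact (Measurable.indicator (by fun_prop) measurableSet_Icc).add
    (Measurable.indicator (by fun_prop) measurableSet_Ioc)

omit h in
theorem measurable_psi : Measurable (psi b) := by
  rw [psi_eq_indicator]
  exact measurable_const.indicator measurableSet_Icc

theorem isProbabilityMeasure_phi : IsProbabilityMeasure (densityMeasure (phi a b c d)) := by
  have hi1 : IntegrableOn (fun u : ℝ => a * u) (Set.Icc 0 b) :=
    (by fun_prop : Continuous fun u : ℝ => a * u).integrableOn_Icc
  have hi2 : IntegrableOn (fun u : ℝ => c * u + d) (Set.Ioc b 1) :=
    (by fun_prop : Continuous fun u : ℝ => c * u + d).integrableOn_Ioc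
  have hi1' := hi1.integrable_indicator measurableSet_Icc
  have hi2' := hi2.integrable_indicator measurableSet_Ioc
  refine isProbabilityMeasure_densityMeasure ?_ h.phi_nonneg ?_
  · rw [phi_eq_indicator]
    exact hi1'.add hi2'
  · rw [phi_eq_indicator, integral_add hi1' hi2', integral_indicator measurableSet_Icc,
      integral_indicator measurableSet_Ioc, integral_Icc_eq_integral_Ioc,
      ← intervalIntegral.integral_of_le h.b_pos.le,
      ← intervalIntegral.integral_of_le h.b_lt_one.le, intervalIntegral.integral_const_mul,
      intervalIntegral.integral_add (by apply Continuous.intervalIntegrable; fun_prop)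
        (by apply Continuous.intervalIntegrable; fun_prop),
      intervalIntegral.integral_const_mul, integral_id, integral_id, intervalIntegral.integral_const,
      h.a_eq, h.b_eq, h.c_eq, h.d_eq, smul_eq_mul]
    have h3 : √3 ^ 3 = 3 * √3 := by rw [pow_succ, sqrt_three_sq]
    ring_nf
    rw [h3, sqrt_three_sq]
    ring

theorem isProbabilityMeasure_psi : IsProbabilityMeasure (densityMeasure (psi b)) := by
  have hi : IntegrableOn (fun _ : ℝ => 1 / b) (Set.Icc 0 b) := continuous_const.integrableOn_Icc
  refine isProbabilityMeasure_densityMeasure ?_ h.psi_nonneg ?_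
  · rw [psi_eq_indicator]
    exact hi.integrable_indicator measurableSet_Icc
  · rw [psi_eq_indicator, integral_indicator measurableSet_Icc, integral_Icc_eq_integral_Ioc,
      ← intervalIntegral.integral_of_le h.b_pos.le, intervalIntegral.integral_const, smul_eq_mul,
      sub_zero, mul_one_div_cancel h.b_pos.ne']

/-! ### Masses of short intervals under the two densities. -/

theorem phi_real_Ioc_le_low {s t : ℝ} (hst : s ≤ t) (ht : 0 ≤ t) (htb : t ≤ b) :
    (densityMeasure (phi a b c d)).real (Set.Ioc s t) ≤ a * t * (t - s) :=
  densityMeasure_real_Ioc_le hst (mul_nonneg h.a_pos.le ht)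
    fun _ hu => h.phi_le_of_le ht htb hu.2

theorem phi_real_Ioc_le_high {s t : ℝ} (hst : s ≤ t) (hsb : b ≤ s) :
    (densityMeasure (phi a b c d)).real (Set.Ioc s t) ≤ (c * t + d) * (t - s) :=
  densityMeasure_real_Ioc_le hst
    (add_nonneg (mul_nonneg h.c_pos.le (h.b_pos.le.trans (hsb.trans hst))) h.d_pos.le)
    fun _ hu => h.phi_le_of_lt (hsb.trans_lt hu.1) hu.2

theorem phi_real_Ioc_le {s t : ℝ} (hst : s ≤ t) :
    (densityMeasure (phi a b c d)).real (Set.Ioc s t) ≤ (a + c + d) * (t - s) :=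
  densityMeasure_real_Ioc_le hst (by linarith [h.a_pos, h.c_pos, h.d_pos]) fun u _ => h.phi_le u

theorem psi_real_Ioc_le {s t : ℝ} (hst : s ≤ t) :
    (densityMeasure (psi b)).real (Set.Ioc s t) ≤ 1 / b * (t - s) :=
  densityMeasure_real_Ioc_le hst (one_div_pos.2 h.b_pos).le fun u _ => h.psi_le u

omit h in
theorem psi_real_Ioc_of_le {s t : ℝ} (hsb : b ≤ s) (hst : s ≤ t) :
    (densityMeasure (psi b)).real (Set.Ioc s t) = 0 := by
  refine le_antisymm ?_ measureReal_nonneg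
  have := densityMeasure_real_Ioc_le (f := psi b) hst le_rfl
    fun u hu => (psi_of_lt (hsb.trans_lt hu.1)).le
  rwa [zero_mul] at this

/-- The end `r` cuts the interval off at `b`, beyond which `psi` has no mass: it is `t` when `t ≤
b`, and `b` otherwise. -/
theorem le_psi_real_Ioc {s t r : ℝ} (hs : 0 ≤ s) (hrt : r ≤ t) (hrb : r ≤ b) :
    1 / b * (r - s) ≤ (densityMeasure (psi b)).real (Set.Ioc s t) := by
  have := h.isProbabilityMeasure_psi
  refine (le_densityMeasure_real_Ioc (one_div_pos.2 h.b_pos).le fun u hu => ?_).trans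
    (measureReal_mono (Set.Ioc_subset_Ioc_right hrt))
  exact (psi_of_mem (hs.trans hu.1.le) (hu.2.trans hrb)).ge

end IsBalanced

/-! ### Points of the simplex -/

section Simplex

variable {k : ℕ}

theorem shift_shift (x : Fin k → ℝ) (i j : Fin k) (s t : ℝ) :
    shift (shift x i j s) i j t = shift x i j (s + t) := by
  funext l
  simp only [shift, Pi.add_apply, Pi.sub_apply, Pi.single_add]
  ring

theorem shift_zero (x : Fin k → ℝ) (i j : Fin k) : shift x i j 0 = x := by
  simp [shift]

theorem sum_shift (x : Fin k → ℝ) (i j : Fin k) (ε : ℝ) : ∑ l, shift x i j ε l = ∑ l, x l := by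
  simp [shift, Finset.sum_add_distrib, Finset.sum_sub_distrib]

theorem shift_mem_stdSimplex {x : Fin k → ℝ} (hx : x ∈ stdSimplex ℝ (Fin k)) {i j : Fin k}
    (hij : i ≠ j) {ε : ℝ} (hε : 0 ≤ ε) (h : ε ≤ x j) :
    shift x i j ε ∈ stdSimplex ℝ (Fin k) := by
  refine ⟨fun l => ?_, by rw [sum_shift, hx.2]⟩
  by_cases hi : l = i
  · rw [hi, shift_apply_left hij]
    exact add_nonneg (hx.1 i) hε
  · by_cases hj : l = j
    · rw [hj, shift_apply_right hij]
      linarith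
    · rw [shift_apply_of_ne hi hj]
      exact hx.1 l

theorem le_of_shift_mem_stdSimplex {x : Fin k → ℝ} {i j : Fin k} (hij : i ≠ j) {ε : ℝ}
    (h : shift x i j ε ∈ stdSimplex ℝ (Fin k)) : ε ≤ x j := by
  have := h.1 j
  rw [shift_apply_right hij] at this
  linarith

end Simplex

/-! ### Separation probabilities of an arbitrary scheme -/

section Separation

variable {k : ℕ} {R : Measure (Labeling k)} [IsFiniteMeasure R]

theorem real_label_ne_triangle (x y z : Fin k → ℝ) :
    R.real {ℓ | ℓ x ≠ ℓ z} ≤ R.real {ℓ | ℓ x ≠ ℓ y} + R.real {ℓ | ℓ y ≠ ℓ z} := by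
  refine (measureReal_mono fun ℓ hℓ => ?_).trans (measureReal_union_le _ _)
  by_contra hcon
  obtain ⟨h1, h2⟩ := not_or.1 hcon
  exact hℓ ((not_not.1 h1).trans (not_not.1 h2))

omit [IsFiniteMeasure R] in
theorem real_label_ne_self (x : Fin k → ℝ) : R.real {ℓ | ℓ x ≠ ℓ x} = 0 := by
  simp

omit [IsFiniteMeasure R] in
theorem real_label_ne_comm (x y : Fin k → ℝ) :
    R.real {ℓ | ℓ x ≠ ℓ y} = R.real {ℓ | ℓ y ≠ ℓ x} := by
  simp only [ne_comm]

/-- A bound on the rate at which a scheme separates the points of a segment of type `(i, j)`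
integrates to a bound for its endpoints. -/
theorem real_label_ne_shift_le {i j : Fin k} (hij : i ≠ j) {C T : ℝ}
    (hC : ∀ x ∈ stdSimplex ℝ (Fin k), ∀ ε, 0 ≤ ε → shift x i j ε ∈ stdSimplex ℝ (Fin k) →
      R.real {ℓ | ℓ x ≠ ℓ (shift x i j ε)} ≤ C * ε)
    (hT : ∀ x ∈ stdSimplex ℝ (Fin k), ∀ δ > 0, ∀ᶠ ε in 𝓝[>] (0 : ℝ),
      shift x i j ε ∈ stdSimplex ℝ (Fin k) →
        R.real {ℓ | ℓ x ≠ ℓ (shift x i j ε)} ≤ (T + δ) * ε)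
    {x : Fin k → ℝ} (hx : x ∈ stdSimplex ℝ (Fin k)) {L : ℝ} (hL : 0 ≤ L)
    (hxL : shift x i j L ∈ stdSimplex ℝ (Fin k)) :
    R.real {ℓ | ℓ x ≠ ℓ (shift x i j L)} ≤ T * L := by
  have hLj := le_of_shift_mem_stdSimplex hij hxL
  have hmem : ∀ t ∈ Set.Icc 0 L, shift x i j t ∈ stdSimplex ℝ (Fin k) := fun t ht =>
    shift_mem_stdSimplex hx hij ht.1 (ht.2.trans hLj)
  have hshift : ∀ s t, shift x i j t = shift (shift x i j s) i j (t - s) := fun s t => by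
    rw [shift_shift, add_sub_cancel]
  have hstep : ∀ s ∈ Set.Icc 0 L, ∀ t ∈ Set.Icc 0 L, s ≤ t →
      R.real {ℓ | ℓ (shift x i j s) ≠ ℓ (shift x i j t)} ≤ C * (t - s) := by
    intro s hs t ht hst
    have h := hC _ (hmem s hs) (t - s) (sub_nonneg.2 hst) (by rw [← hshift]; exact hmem t ht)
    rwa [← hshift] at h
  let f : ℝ → ℝ := fun t => R.real {ℓ | ℓ x ≠ ℓ (shift x i j t)}
  have hdist : ∀ s ∈ Set.Icc 0 L, ∀ t ∈ Set.Icc 0 L, s ≤ t → |f t - f s| ≤ C * (t - s) := by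
    intro s hs t ht hst
    refine abs_sub_le_iff.2 ⟨?_, ?_⟩
    · have := real_label_ne_triangle (R := R) x (shift x i j s) (shift x i j t)
      linarith [hstep s hs t ht hst]
    · have := real_label_ne_triangle (R := R) x (shift x i j t) (shift x i j s)
      rw [real_label_ne_comm (shift x i j t)] at this
      linarith [hstep s hs t ht hst]
  -- Right slopes do not detect a jump from the left; the uniform constant `C` serves only to
  -- exclude such jumps.
  have hcont : ContinuousOn f (Set.Icc 0 L) := by
    refine LipschitzOnWith.continuousOn (K := C.toNNReal)
      (LipschitzOnWith.of_dist_le_mul fun s hs t ht => ?_)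
    have hC' : C ≤ C.toNNReal := Real.le_coe_toNNReal C
    rcases le_total s t with hst | hst
    · rw [dist_comm, dist_comm s, Real.dist_eq, Real.dist_eq, abs_of_nonneg (sub_nonneg.2 hst)]
      exact (hdist s hs t ht hst).trans (mul_le_mul_of_nonneg_right hC' (sub_nonneg.2 hst))
    · rw [Real.dist_eq, Real.dist_eq, abs_of_nonneg (sub_nonneg.2 hst)]
      exact (hdist t ht s hs hst).trans (mul_le_mul_of_nonneg_right hC' (sub_nonneg.2 hst))
  refine image_le_of_liminf_slope_right_le_deriv_boundary (f := f) (B := fun t => T * t)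
    (B' := fun _ => T) hcont ?_ (by fun_prop) (fun t _ => ?_) (fun t ht r hr => ?_)
    (Set.right_mem_Icc.2 hL)
  · simp only [f, shift_zero, real_label_ne_self, mul_zero, le_refl]
  · simpa using ((hasDerivAt_id t).const_mul T).hasDerivWithinAt
  · refine Eventually.frequently ?_
    have htend : Tendsto (fun z => z - t) (𝓝[>] t) (𝓝[>] 0) := by
      refine tendsto_nhdsWithin_iff.2 ⟨?_, ?_⟩
      · have : Tendsto (fun z => z - t) (𝓝 t) (𝓝 (t - t)) := (continuous_sub_right t).tendsto t
        rw [sub_self] at this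
        exact this.mono_left nhdsWithin_le_nhds
      · filter_upwards [self_mem_nhdsWithin] with z hz
        exact sub_pos.2 (Set.mem_Ioi.1 hz)
    have ht' : t ∈ Set.Icc 0 L := ⟨ht.1, ht.2.le⟩
    -- Half of the margin `r - T` serves as `δ`, so that the slope is strictly below `r`.
    filter_upwards [htend.eventually (hT _ (hmem t ht') ((r - T) / 2) (by linarith)),
      self_mem_nhdsWithin, mem_nhdsWithin_of_mem_nhds (Iio_mem_nhds ht.2)] with z h1 h2 h3
    have hz : 0 < z - t := sub_pos.2 h2
    have hzI : z ∈ Set.Icc 0 L := ⟨ht.1.trans (le_of_lt h2), le_of_lt h3⟩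
    rw [← hshift] at h1
    have h4 := h1 (hmem z hzI)
    have h5 : f z ≤ f t + R.real {ℓ | ℓ (shift x i j t) ≠ ℓ (shift x i j z)} :=
      real_label_ne_triangle _ _ _
    rw [slope_def_field, div_lt_iff₀ hz]
    nlinarith

/-- A bound for the edges of type `(i, j)` extends to all pairs of points of the simplex. -/
theorem real_label_ne_le_half_dist {T : ℝ}
    (hT : ∀ i j : Fin k, i ≠ j → ∀ x ∈ stdSimplex ℝ (Fin k), ∀ ε, 0 ≤ ε →
      shift x i j ε ∈ stdSimplex ℝ (Fin k) → R.real {ℓ | ℓ x ≠ ℓ (shift x i j ε)} ≤ T * ε)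
    {x y : Fin k → ℝ} (hx : x ∈ stdSimplex ℝ (Fin k)) (hy : y ∈ stdSimplex ℝ (Fin k)) :
    R.real {ℓ | ℓ x ≠ ℓ y} ≤ T * (1 / 2 * ∑ l, |x l - y l|) := by
  -- Induction on the number of coordinates in which the two points differ.
  induction hn : (Finset.univ.filter fun l => x l ≠ y l).card using Nat.strong_induction_on
    generalizing x with
  | _ n ih =>
  by_cases hxy : x = y
  · subst hxy
    simp
  obtain ⟨i, hi⟩ : ∃ i, x i < y i := by
    by_contra! hcon
    refine hxy (funext fun l => ?_)
    exact ((Finset.sum_eq_sum_iff_of_le fun l _ => hcon l).1 (hy.2.trans hx.2.symm) l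
      (Finset.mem_univ l)).symm
  obtain ⟨j, hj⟩ : ∃ j, y j < x j := by
    by_contra! hcon
    refine hxy (funext fun l => ?_)
    exact (Finset.sum_eq_sum_iff_of_le fun l _ => hcon l).1 (hx.2.trans hy.2.symm) l
      (Finset.mem_univ l)
  have hij : i ≠ j := fun e => by
    subst e
    exact lt_asymm hi hj
  -- The largest step that overshoots neither `y i` nor `y j`. It makes at least one of these
  -- coordinates agree with `y`.
  set ε := min (y i - x i) (x j - y j) with hε
  have hε0 : 0 < ε := lt_min (sub_pos.2 hi) (sub_pos.2 hj)
  have hεi : ε ≤ y i - x i := min_le_left _ _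
  have hεj : ε ≤ x j - y j := min_le_right _ _
  have hz : shift x i j ε ∈ stdSimplex ℝ (Fin k) :=
    shift_mem_stdSimplex hx hij hε0.le (hεj.trans (by linarith [hy.1 j]))
  have hzi := shift_apply_left (x := x) hij ε
  have hzj := shift_apply_right (x := x) hij ε
  have hlt : (Finset.univ.filter fun l => shift x i j ε l ≠ y l).card < n := by
    rw [← hn]
    refine Finset.card_lt_card ((Finset.ssubset_iff_of_subset fun l hl => ?_).2 ?_)
    · simp only [Finset.mem_filter, Finset.mem_univ, true_and] at hl ⊢
      by_cases h1 : l = i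
      · rw [h1]
        exact hi.ne
      · by_cases h2 : l = j
        · rw [h2]
          exact hj.ne'
        · rwa [shift_apply_of_ne h1 h2] at hl
    · simp only [Finset.mem_filter, Finset.mem_univ, true_and, not_not]
      rcases min_choice (y i - x i) (x j - y j) with h | h
      · exact ⟨i, hi.ne, by rw [hzi, hε, h]; ring⟩
      · exact ⟨j, hj.ne', by rw [hzj, hε, h]; ring⟩
  -- Without overshooting, the `ℓ₁` distance drops by exactly `2 ε`, so the half-distances add up
  -- along the path.
  have hsum : ∑ l, |shift x i j ε l - y l| = ∑ l, |x l - y l| - 2 * ε := by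
    have h : ∑ l, (|x l - y l| - |shift x i j ε l - y l|) = ε + ε := by
      rw [Finset.sum_eq_add i j hij]
      · rw [hzi, hzj, abs_of_neg (sub_neg.2 hi), abs_of_pos (sub_pos.2 hj),
          abs_of_nonpos (by linarith), abs_of_nonneg (by linarith)]
        ring
      · intro l _ hl
        rw [shift_apply_of_ne hl.1 hl.2, sub_self]
      · simp
      · simp
    rw [Finset.sum_sub_distrib] at h
    linarith
  have h1 := ih _ hlt hz rfl
  have h2 := hT i j hij x hx ε hε0.le hz
  have h3 := real_label_ne_triangle (R := R) x (shift x i j ε) y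
  rw [hsum] at h1
  linarith

end Separation

/-! ### Separation probabilities of the combined scheme -/

section Combined

variable {k : ℕ} [NeZero k] {p₁ p₂ p₃ a b c d : ℝ}

theorem IsBalanced.isProbabilityMeasure_combinedScheme (h : IsBalanced p₁ p₂ p₃ a b c d) :
    IsProbabilityMeasure (combinedScheme k p₁ p₂ p₃ a b c d) := by
  have := h.isProbabilityMeasure_phi
  have := h.isProbabilityMeasure_psi
  have := isProbabilityMeasure_singleThreshold (k := k) (φ := phi a b c d)
  have := isProbabilityMeasure_descendingThresholds (k := k) (ψ := psi b)
  refine ⟨?_⟩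
  simp only [combinedScheme, Measure.add_apply, Measure.smul_apply, measure_univ, smul_eq_mul,
    mul_one]
  rw [← ENNReal.ofReal_add h.p₁_pos.le h.p₂_pos.le,
    ← ENNReal.ofReal_add (add_pos h.p₁_pos h.p₂_pos).le h.p₃_pos.le, h.sum_eq_one,
    ENNReal.ofReal_one]

theorem IsBalanced.combinedScheme_real (h : IsBalanced p₁ p₂ p₃ a b c d) (s : Set (Labeling k)) :
    (combinedScheme k p₁ p₂ p₃ a b c d).real s = p₁ * (exponentialClocks k).real s +
      p₂ * (singleThreshold k (phi a b c d)).real s +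
      p₃ * (descendingThresholds k (psi b)).real s := by
  have := h.isProbabilityMeasure_phi
  have := h.isProbabilityMeasure_psi
  have := isProbabilityMeasure_singleThreshold (k := k) (φ := phi a b c d)
  have := isProbabilityMeasure_descendingThresholds (k := k) (ψ := psi b)
  have hfin : ∀ (p : ℝ) (μ : Measure (Labeling k)) [IsProbabilityMeasure μ],
      ENNReal.ofReal p * μ s ≠ ∞ := fun p μ _ =>
    ENNReal.mul_ne_top ENNReal.ofReal_ne_top (measure_ne_top _ _)
  simp only [combinedScheme, measureReal_def, Measure.add_apply, Measure.smul_apply, smul_eq_mul]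
  rw [ENNReal.toReal_add (ENNReal.add_ne_top.2 ⟨hfin _ _, hfin _ _⟩) (hfin _ _),
    ENNReal.toReal_add (hfin _ _) (hfin _ _)]
  simp only [ENNReal.toReal_mul,
    ENNReal.toReal_ofReal h.p₁_pos.le, ENNReal.toReal_ofReal h.p₂_pos.le,
    ENNReal.toReal_ofReal h.p₃_pos.le]

theorem IsBalanced.combinedScheme_real_le (h : IsBalanced p₁ p₂ p₃ a b c d)
    {s : Set (Labeling k)} {ε E S D T : ℝ} (hε : 0 ≤ ε)
    (hE : (exponentialClocks k).real s ≤ ε * E)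
    (hS : (singleThreshold k (phi a b c d)).real s ≤ ε * S)
    (hD : (descendingThresholds k (psi b)).real s ≤ ε * D)
    (hT : p₁ * E + p₂ * S + p₃ * D ≤ T) :
    (combinedScheme k p₁ p₂ p₃ a b c d).real s ≤ T * ε := by
  rw [h.combinedScheme_real]
  have h1 := mul_le_mul_of_nonneg_left hE h.p₁_pos.le
  have h2 := mul_le_mul_of_nonneg_left hS h.p₂_pos.le
  have h3 := mul_le_mul_of_nonneg_left hD h.p₃_pos.le
  have h4 := mul_le_mul_of_nonneg_left hT hε
  linarith

/-- A crude bound, uniform in `x` and `ε`, that supplies the constant `C` of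
`real_label_ne_shift_le`. -/
theorem IsBalanced.cut_le_const_mul (h : IsBalanced p₁ p₂ p₃ a b c d) {i j : Fin k} (hij : i ≠ j)
    {x : Fin k → ℝ} (hx : x ∈ stdSimplex ℝ (Fin k)) {ε : ℝ} (hε : 0 ≤ ε)
    (hy : shift x i j ε ∈ stdSimplex ℝ (Fin k)) :
    (combinedScheme k p₁ p₂ p₃ a b c d).real {ℓ | ℓ x ≠ ℓ (shift x i j ε)} ≤
      (p₁ * 2 + p₂ * (2 * (a + c + d)) + p₃ * (2 * (1 / b))) * ε := by
  have := h.isProbabilityMeasure_phi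
  have := h.isProbabilityMeasure_psi
  refine h.combinedScheme_real_le hε ?_ ?_ ?_ le_rfl
  · refine (exponentialClocks_cut_le hij hε hx hy).trans (mul_le_mul_of_nonneg_left ?_ hε)
    linarith [hx.1 i, hx.1 j]
  · have h1 := h.phi_real_Ioc_le (s := x i) (t := x i + ε) (by linarith)
    have h2 := h.phi_real_Ioc_le (s := x j - ε) (t := x j) (by linarith)
    have h3 := singleThreshold_real_le (φ := phi a b c d)
      (measurableSet_label_ne x (shift x i j ε)) hij (A := 0)
      (B := (densityMeasure (phi a b c d)).real (Set.Ioc (x i) (x i + ε)) +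
        (densityMeasure (phi a b c d)).real (Set.Ioc (x j - ε) (x j))) fun σ => by
        rw [ite_self, zero_add]
        refine (measureReal_mono fun θ hθ => ?_).trans (measureReal_union_le _ _)
        exact (thresholdLabel_shift_ne hij hε hθ).imp And.left And.left
    linarith
  · have h1 := h.psi_real_Ioc_le (s := x i) (t := x i + ε) (by linarith)
    have h2 := h.psi_real_Ioc_le (s := x j - ε) (t := x j) (by linarith)
    have h3 := descendingThresholds_cut_le_of_le (ψ := psi b) (x := x) hij hε
    have h4 : (densityMeasure (psi b)).real (Set.Ioc (x j - ε) (x j)) *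
        (1 - (densityMeasure (psi b)).real (Set.Ioc (x j) (x i))) ≤
        (densityMeasure (psi b)).real (Set.Ioc (x j - ε) (x j)) :=
      mul_le_of_le_one_right measureReal_nonneg (sub_le_self _ measureReal_nonneg)
    linarith

theorem mul_one_sub_le {n q m r ε : ℝ} (hn : n ≤ m * ε) (hm : 0 ≤ m * ε) (hq : q ≤ 1)
    (hr : r ≤ q) : n * (1 - q) ≤ ε * (m * (1 - r)) := by
  calc n * (1 - q) ≤ m * ε * (1 - q) := mul_le_mul_of_nonneg_right hn (by linarith)
    _ ≤ m * ε * (1 - r) := mul_le_mul_of_nonneg_left (by linarith) hm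
    _ = ε * (m * (1 - r)) := by ring

/-- The cases follow the position of `x j ≤ x i` relative to `b`, where both densities jump. The
half-open intervals settle the boundary: `(x i, x i + ε]` is on the high side already for `x i = b`,
while `(x j - ε, x j]` is on the low side up to `x j = b`. -/
theorem IsBalanced.cut_le_of_le (h : IsBalanced p₁ p₂ p₃ a b c d) {i j : Fin k} (hij : i ≠ j)
    {x : Fin k → ℝ} (hx : x ∈ stdSimplex ℝ (Fin k)) (hji : x j ≤ x i) {δ : ℝ} (hδ : 0 < δ) :
    ∀ᶠ ε in 𝓝[>] (0 : ℝ), shift x i j ε ∈ stdSimplex ℝ (Fin k) →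
      (combinedScheme k p₁ p₂ p₃ a b c d).real {ℓ | ℓ x ≠ ℓ (shift x i j ε)} ≤
        ((10 + 4 * √3) / 13 + δ) * ε := by
  have := h.isProbabilityMeasure_phi
  have := h.isProbabilityMeasure_psi
  have ha := h.a_pos
  have hc := h.c_pos
  have hp₂ := h.p₂_pos
  have hp₃ := h.p₃_pos
  have hib : 0 < 1 / b := one_div_pos.2 h.b_pos
  have hi0 := hx.1 i
  have hj0 := hx.1 j
  have hsmall : ∀ {r : ℝ}, 0 < r → ∀ᶠ ε in 𝓝[>] (0 : ℝ), ε < r := fun hr =>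
    mem_nhdsWithin_of_mem_nhds (Iio_mem_nhds hr)
  have hEC : ∀ {ε : ℝ}, 0 ≤ ε → shift x i j ε ∈ stdSimplex ℝ (Fin k) →
      (exponentialClocks k).real {ℓ | ℓ x ≠ ℓ (shift x i j ε)} ≤ ε * (2 - x j - x i) :=
    fun hε hy => (exponentialClocks_cut_le hij hε hx hy).trans_eq (by ring)
  have hq : (densityMeasure (psi b)).real (Set.Ioc (x j) (x i)) ≤ 1 := measureReal_le_one
  rcases lt_or_ge (x i) b with hib' | hib'
  -- The first bound keeps `x i + ε` below `b`; the second absorbs the error `p₂ a ε` from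
  -- evaluating `phi` at the right end `x i + ε`.
  · filter_upwards [self_mem_nhdsWithin, hsmall (sub_pos.2 hib'),
      hsmall (div_pos hδ (mul_pos hp₂ ha))] with ε hε h1 h2 hy
    have hε : 0 < ε := hε
    rw [lt_div_iff₀ (mul_pos hp₂ ha)] at h2
    refine h.combinedScheme_real_le hε.le (S := a * x j / 2 + a * (x i + ε))
      (D := 1 / b * (1 - 1 / b * (x i - x j)) + 1 / b) (hEC hε.le hy) ?_ ?_ ?_
    · have f1 := h.phi_real_Ioc_le_low (s := x j - ε) (t := x j) (by linarith) hj0 (by linarith)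
      have f2 := h.phi_real_Ioc_le_low (s := x i) (t := x i + ε) (by linarith) (by linarith)
        (by linarith)
      have := singleThreshold_cut_le_of_le (φ := phi a b c d) hij hε.le hji
      linarith
    · have n1 := h.psi_real_Ioc_le (s := x j - ε) (t := x j) (by linarith)
      have n2 := h.psi_real_Ioc_le (s := x i) (t := x i + ε) (by linarith)
      have n3 := h.le_psi_real_Ioc (s := x j) (t := x i) hj0 le_rfl hib'.le
      rw [sub_sub_cancel] at n1
      have n4 := mul_one_sub_le n1 (by positivity) hq n3
      have := descendingThresholds_cut_le_of_le (ψ := psi b) (x := x) hij hε.le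
      linarith
    · linarith [h.density_low_low (x j) (x i)]
  · rcases le_or_gt (x j) b with hjb | hjb
    · filter_upwards [self_mem_nhdsWithin, hsmall (div_pos hδ (mul_pos hp₂ hc))] with ε hε h2 hy
      have hε : 0 < ε := hε
      rw [lt_div_iff₀ (mul_pos hp₂ hc)] at h2
      refine h.combinedScheme_real_le hε.le (S := a * x j / 2 + (c * (x i + ε) + d))
        (D := 1 / b * (1 - 1 / b * (b - x j))) (hEC hε.le hy) ?_ ?_ ?_
      · have f1 := h.phi_real_Ioc_le_low (s := x j - ε) (t := x j) (by linarith) hj0 hjb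
        have f2 := h.phi_real_Ioc_le_high (s := x i) (t := x i + ε) (by linarith) hib'
        have := singleThreshold_cut_le_of_le (φ := phi a b c d) hij hε.le hji
        linarith
      · have n1 := h.psi_real_Ioc_le (s := x j - ε) (t := x j) (by linarith)
        have n2 := IsBalanced.psi_real_Ioc_of_le (s := x i) (t := x i + ε) hib' (by linarith)
        have n3 := h.le_psi_real_Ioc (s := x j) (t := x i) hj0 hib' le_rfl
        rw [sub_sub_cancel] at n1
        have n4 := mul_one_sub_le n1 (by positivity) hq n3
        have := descendingThresholds_cut_le_of_le (ψ := psi b) (x := x) hij hε.le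
        linarith
      · linarith [h.density_low_high (x j) (x i)]
    · filter_upwards [self_mem_nhdsWithin, hsmall (sub_pos.2 hjb),
        hsmall (div_pos hδ (mul_pos hp₂ hc))] with ε hε h1 h2 hy
      have hε : 0 < ε := hε
      rw [lt_div_iff₀ (mul_pos hp₂ hc)] at h2
      refine h.combinedScheme_real_le hε.le (S := (c * x j + d) / 2 + (c * (x i + ε) + d))
        (D := 0) (hEC hε.le hy) ?_ ?_ ?_
      · have f1 := h.phi_real_Ioc_le_high (s := x j - ε) (t := x j) (by linarith) (by linarith)
        have f2 := h.phi_real_Ioc_le_high (s := x i) (t := x i + ε) (by linarith) hib'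
        have := singleThreshold_cut_le_of_le (φ := phi a b c d) hij hε.le hji
        linarith
      · have n1 := IsBalanced.psi_real_Ioc_of_le (b := b) (s := x j - ε) (t := x j)
          (by linarith) (by linarith)
        have n2 := IsBalanced.psi_real_Ioc_of_le (s := x i) (t := x i + ε) hib' (by linarith)
        have := descendingThresholds_cut_le_of_le (ψ := psi b) (x := x) hij hε.le
        rw [n1, n2] at this
        linarith
      · linarith [h.density_high_high (x i) hjb.le]

theorem IsBalanced.cut_le_of_lt (h : IsBalanced p₁ p₂ p₃ a b c d) {i j : Fin k} (hij : i ≠ j)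
    {x : Fin k → ℝ} (hx : x ∈ stdSimplex ℝ (Fin k)) (hlt : x i < x j) {δ : ℝ} (hδ : 0 < δ) :
    ∀ᶠ ε in 𝓝[>] (0 : ℝ), shift x i j ε ∈ stdSimplex ℝ (Fin k) →
      (combinedScheme k p₁ p₂ p₃ a b c d).real {ℓ | ℓ x ≠ ℓ (shift x i j ε)} ≤
        ((10 + 4 * √3) / 13 + δ) * ε := by
  have := h.isProbabilityMeasure_phi
  have := h.isProbabilityMeasure_psi
  have ha := h.a_pos
  have hc := h.c_pos
  have hp₂ := h.p₂_pos
  have hp₃ := h.p₃_pos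
  have hib : 0 < 1 / b := one_div_pos.2 h.b_pos
  have hi0 := hx.1 i
  have hj0 := hx.1 j
  have hsmall : ∀ {r : ℝ}, 0 < r → ∀ᶠ ε in 𝓝[>] (0 : ℝ), ε < r := fun hr =>
    mem_nhdsWithin_of_mem_nhds (Iio_mem_nhds hr)
  have hEC : ∀ {ε : ℝ}, 0 ≤ ε → shift x i j ε ∈ stdSimplex ℝ (Fin k) →
      (exponentialClocks k).real {ℓ | ℓ x ≠ ℓ (shift x i j ε)} ≤ ε * (2 - x i - x j) :=
    fun hε hy => exponentialClocks_cut_le hij hε hx hy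
  have hq : ∀ ε, (densityMeasure (psi b)).real (Set.Ioc (x i + ε) (x j - ε)) ≤ 1 := fun _ =>
    measureReal_le_one
  have hgap : 0 < (x j - x i) / 2 := by linarith
  -- The error per unit of `ε`: `p₂ a / 2` from evaluating `phi` at `x i + ε`, and `2 p₃ / b²` from
  -- trimming the interval for `θ j` by `ε` at each end.
  let K := p₂ * a / 2 + 2 * (p₃ * (1 / b * (1 / b)))
  have hK : 0 < K := by positivity
  rcases le_or_gt (x j) b with hjb | hjb
  · filter_upwards [self_mem_nhdsWithin, hsmall hgap, hsmall (div_pos hδ hK)] with ε hε h1 h2 hy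
    have hε : 0 < ε := hε
    rw [lt_div_iff₀ hK] at h2
    simp only [K] at h2
    refine h.combinedScheme_real_le hε.le (S := a * (x i + ε) / 2 + a * x j)
      (D := 1 / b * (1 - 1 / b * (x j - ε - (x i + ε))) + 1 / b) (hEC hε.le hy) ?_ ?_ ?_
    · have f1 := h.phi_real_Ioc_le_low (s := x j - ε) (t := x j) (by linarith) hj0 hjb
      have f2 := h.phi_real_Ioc_le_low (s := x i) (t := x i + ε) (by linarith) (by linarith)
        (by linarith)
      have := singleThreshold_cut_le_of_lt (φ := phi a b c d) (x := x) hij hε.le (by linarith)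
      linarith
    · have n1 := h.psi_real_Ioc_le (s := x i) (t := x i + ε) (by linarith)
      have n2 := h.psi_real_Ioc_le (s := x j - ε) (t := x j) (by linarith)
      have n3 := h.le_psi_real_Ioc (s := x i + ε) (t := x j - ε) (by linarith) le_rfl
        (by linarith)
      rw [add_sub_cancel_left] at n1
      have n4 := mul_one_sub_le n1 (by positivity) (hq ε) n3
      have := descendingThresholds_cut_le_of_lt (ψ := psi b) (x := x) hij hε.le
      linarith
    · linarith [h.density_low_low (x i) (x j)]
  · rcases lt_or_ge (x i) b with hib' | hib'
    · filter_upwards [self_mem_nhdsWithin, hsmall hgap, hsmall (sub_pos.2 hib'),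
        hsmall (sub_pos.2 hjb), hsmall (div_pos hδ hK)] with ε hε h1 h3 h4 h2 hy
      have hε : 0 < ε := hε
      rw [lt_div_iff₀ hK] at h2
      simp only [K] at h2
      refine h.combinedScheme_real_le hε.le (S := a * (x i + ε) / 2 + (c * x j + d))
        (D := 1 / b * (1 - 1 / b * (b - (x i + ε)))) (hEC hε.le hy) ?_ ?_ ?_
      · have f1 := h.phi_real_Ioc_le_high (s := x j - ε) (t := x j) (by linarith) (by linarith)
        have f2 := h.phi_real_Ioc_le_low (s := x i) (t := x i + ε) (by linarith) (by linarith)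
          (by linarith)
        have := singleThreshold_cut_le_of_lt (φ := phi a b c d) (x := x) hij hε.le (by linarith)
        linarith
      · have n1 := h.psi_real_Ioc_le (s := x i) (t := x i + ε) (by linarith)
        have n2 := IsBalanced.psi_real_Ioc_of_le (b := b) (s := x j - ε) (t := x j)
          (by linarith) (by linarith)
        have n3 := h.le_psi_real_Ioc (s := x i + ε) (t := x j - ε) (r := b) (by linarith)
          (by linarith) le_rfl
        rw [add_sub_cancel_left] at n1
        have n4 := mul_one_sub_le n1 (by positivity) (hq ε) n3
        have := descendingThresholds_cut_le_of_lt (ψ := psi b) (x := x) hij hε.le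
        linarith
      -- The interval now ends at `b` and only its left end moves, so one of the two terms `p₃ / b²`
      -- in `K` is spare.
      · have : 0 < p₃ * (1 / b * (1 / b)) * ε := by positivity
        linarith [h.density_low_high (x i) (x j)]
    · filter_upwards [self_mem_nhdsWithin, hsmall hgap, hsmall (sub_pos.2 hjb),
        hsmall (div_pos hδ (mul_pos hp₂ hc))] with ε hε h1 h3 h2 hy
      have hε : 0 < ε := hε
      rw [lt_div_iff₀ (mul_pos hp₂ hc)] at h2
      refine h.combinedScheme_real_le hε.le (S := (c * (x i + ε) + d) / 2 + (c * x j + d))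
        (D := 0) (hEC hε.le hy) ?_ ?_ ?_
      · have f1 := h.phi_real_Ioc_le_high (s := x j - ε) (t := x j) (by linarith) (by linarith)
        have f2 := h.phi_real_Ioc_le_high (s := x i) (t := x i + ε) (by linarith) hib'
        have := singleThreshold_cut_le_of_lt (φ := phi a b c d) (x := x) hij hε.le (by linarith)
        linarith
      · have n1 := IsBalanced.psi_real_Ioc_of_le (b := b) (s := x j - ε) (t := x j)
          (by linarith) (by linarith)
        have n2 := IsBalanced.psi_real_Ioc_of_le (s := x i) (t := x i + ε) hib' (by linarith)
        have := descendingThresholds_cut_le_of_lt (ψ := psi b) (x := x) hij hε.le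
        rw [n1, n2] at this
        linarith
      · linarith [h.density_high_high (x j) hib']

theorem IsBalanced.eventually_cut_le (h : IsBalanced p₁ p₂ p₃ a b c d) {i j : Fin k}
    (hij : i ≠ j) {x : Fin k → ℝ} (hx : x ∈ stdSimplex ℝ (Fin k)) {δ : ℝ} (hδ : 0 < δ) :
    ∀ᶠ ε in 𝓝[>] (0 : ℝ), shift x i j ε ∈ stdSimplex ℝ (Fin k) →
      (combinedScheme k p₁ p₂ p₃ a b c d).real {ℓ | ℓ x ≠ ℓ (shift x i j ε)} ≤
        ((10 + 4 * √3) / 13 + δ) * ε :=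
  (le_or_gt (x j) (x i)).elim (fun hle => h.cut_le_of_le hij hx hle hδ)
    fun hlt => h.cut_le_of_lt hij hx hlt hδ

theorem IsBalanced.cutDensity_le (h : IsBalanced p₁ p₂ p₃ a b c d) {i j : Fin k} (hij : i ≠ j)
    {x : Fin k → ℝ} (hx : x ∈ stdSimplex ℝ (Fin k)) :
    cutDensity (combinedScheme k p₁ p₂ p₃ a b c d) i j x ≤
      ENNReal.ofReal ((10 + 4 * √3) / 13) := by
  have := h.isProbabilityMeasure_combinedScheme (k := k)
  refine ENNReal.le_of_forall_pos_le_add fun δ hδ _ => ?_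
  rw [← ENNReal.ofReal_coe_nnreal, ← ENNReal.ofReal_add (by positivity) δ.coe_nonneg]
  refine limsup_le_of_le (h := ?_)
  have h1 := h.eventually_cut_le hij hx (NNReal.coe_pos.2 hδ)
  rw [eventually_nhdsWithin_iff] at h1 ⊢
  filter_upwards [h1] with ε h2 h3
  refine ENNReal.div_le_of_le_mul ?_
  rw [← ENNReal.ofReal_mul (by positivity), ← ofReal_measureReal]
  exact ENNReal.ofReal_le_ofReal (h2 h3.1 h3.2)

theorem IsBalanced.combinedScheme_label_ne_le (h : IsBalanced p₁ p₂ p₃ a b c d)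
    {x y : Fin k → ℝ} (hx : x ∈ stdSimplex ℝ (Fin k)) (hy : y ∈ stdSimplex ℝ (Fin k)) :
    (combinedScheme k p₁ p₂ p₃ a b c d).real {ℓ | ℓ x ≠ ℓ y} ≤
      (10 + 4 * √3) / 13 * (1 / 2 * ∑ l, |x l - y l|) := by
  have := h.isProbabilityMeasure_combinedScheme (k := k)
  refine real_label_ne_le_half_dist (fun i j hij z hz ε hε hzε => ?_) hx hy
  exact real_label_ne_shift_le hij (fun w hw t ht hwt => h.cut_le_const_mul hij hw ht hwt)
    (fun w hw δ hδ => h.eventually_cut_le hij hw hδ) hz hε hzε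

end Combined

/-! ### The label of a terminal -/

section Terminal

variable {k : ℕ} [NeZero k]

/-- Positive thresholds reject every coordinate equal to `0`, and the catch-all last position cannot
precede that of `i`. -/
theorem thresholdLabel_single {θ : Fin k → ℝ} (σ : Equiv.Perm (Fin k)) {i : Fin k}
    (hpos : ∀ l, 0 < θ l) (hi : θ i ≤ 1) : thresholdLabel θ σ (Pi.single i 1) = i := by
  refine (thresholdLabel_eq_iff θ σ _ i).2 ⟨?_, fun m hm hmem => ?_⟩
  · rw [mem_stops]
    left
    simpa using hi
  · rw [mem_stops] at hmem
    have hne : σ m ≠ i := fun e => hm.ne (by rw [← e, Equiv.symm_apply_apply])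
    rw [Pi.single_eq_of_ne hne] at hmem
    rcases hmem with h | h
    · exact (hpos _).not_ge h
    · have := (σ.symm i).isLt
      have := Fin.lt_def.1 hm
      omega

theorem exponentialClocks_ae_single (i : Fin k) :
    ∀ᵐ ℓ ∂(exponentialClocks k), ℓ (Pi.single i 1) = i := by
  rw [exponentialClocks, ae_map_iff measurable_clockLabel.aemeasurable
    (measurableSet_label_eq _ i)]
  filter_upwards [ae_pos_expMeasure_pi k] with Z hZ
  -- The factor `0` is allowed since all other coordinates of the vertex vanish.
  refine clockLabel_eq_of_lt fun m hm => clockRatio_lt (c := 0) (by simp) (hZ i).le le_rfl ?_ ?_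
  · simp [hm]
  · simpa using hZ m

theorem singleThreshold_ae_single {φ : ℝ → ℝ}
    (hφ : ∀ᵐ θ ∂(densityMeasure φ), 0 < θ ∧ θ ≤ 1) (i : Fin k) :
    ∀ᵐ ℓ ∂(singleThreshold k φ), ℓ (Pi.single i 1) = i := by
  have hm : MeasurableSet {ℓ : Labeling k | ¬ ℓ (Pi.single i 1) = i} :=
    (measurableSet_label_eq _ i).compl
  rw [ae_iff, singleThreshold_apply hm, Finset.sum_eq_zero, mul_zero]
  intro σ _
  refine ae_iff.1 ?_
  filter_upwards [hφ] with θ hθ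
  exact thresholdLabel_single σ (fun _ => hθ.1) hθ.2

theorem descendingThresholds_ae_single {ψ : ℝ → ℝ} [IsProbabilityMeasure (densityMeasure ψ)]
    (hψ : ∀ᵐ θ ∂(densityMeasure ψ), 0 < θ ∧ θ ≤ 1) (i : Fin k) :
    ∀ᵐ ℓ ∂(descendingThresholds k ψ), ℓ (Pi.single i 1) = i := by
  rw [descendingThresholds, ae_map_iff measurable_descendingLabel.aemeasurable
    (measurableSet_label_eq _ i)]
  have h : ∀ᵐ θ ∂(Measure.pi fun _ : Fin k => densityMeasure ψ), ∀ l, 0 < θ l ∧ θ l ≤ 1 :=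
    ae_all_iff.2 fun l => (measurePreserving_eval
      (fun _ : Fin k => densityMeasure ψ) l).quasiMeasurePreserving.ae hψ
  filter_upwards [h] with θ hθ
  exact thresholdLabel_single _ (fun l => (hθ l).1) (hθ i).2

variable {p₁ p₂ p₃ a b c d : ℝ}

omit [NeZero k] in
theorem ae_ne_zero_real : ∀ᵐ u : ℝ, u ≠ 0 := by
  simp [ae_iff]

theorem IsBalanced.ae_phi_mem (h : IsBalanced p₁ p₂ p₃ a b c d) :
    ∀ᵐ θ ∂(densityMeasure (phi a b c d)), 0 < θ ∧ θ ≤ 1 := by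
  refine ae_densityMeasure measurable_phi ?_
  -- The value `0` must be discarded: at threshold `0` every coordinate passes.
  filter_upwards [ae_ne_zero_real] with u hu hne
  have hb := h.b_pos
  have hb1 := h.b_lt_one
  unfold phi at hne
  split_ifs at hne with h1 h2
  · exact ⟨lt_of_le_of_ne h1.1 hu.symm, h1.2.trans hb1.le⟩
  · exact ⟨hb.trans h2.1, h2.2⟩
  · exact absurd rfl hne

theorem IsBalanced.ae_psi_mem (h : IsBalanced p₁ p₂ p₃ a b c d) :
    ∀ᵐ θ ∂(densityMeasure (psi b)), 0 < θ ∧ θ ≤ 1 := by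
  refine ae_densityMeasure measurable_psi ?_
  filter_upwards [ae_ne_zero_real] with u hu hne
  unfold psi at hne
  split_ifs at hne with h1
  · exact ⟨lt_of_le_of_ne h1.1 hu.symm, h1.2.trans h.b_lt_one.le⟩
  · exact absurd rfl hne

theorem IsBalanced.combinedScheme_ae_single (h : IsBalanced p₁ p₂ p₃ a b c d) (i : Fin k) :
    ∀ᵐ ℓ ∂(combinedScheme k p₁ p₂ p₃ a b c d), ℓ (Pi.single i 1) = i := by
  have := h.isProbabilityMeasure_psi
  rw [combinedScheme, ae_add_measure_iff, ae_add_measure_iff]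
  exact ⟨⟨Measure.ae_smul_measure (exponentialClocks_ae_single i) _,
    Measure.ae_smul_measure (singleThreshold_ae_single h.ae_phi_mem i) _⟩,
    Measure.ae_smul_measure (descendingThresholds_ae_single h.ae_psi_mem i) _⟩

end Terminal

namespace Problem

variable {V : Type*} {k : ℕ} (P : Problem V k)

/-! ### Rounding a feasible solution -/

section Rounding

theorem isMultiwayCut_cutEdges [Fintype V] {lab : V → Fin k} (h : ∀ i, lab (P.terminal i) = i) :
    P.IsMultiwayCut (P.cutEdges lab) := by
  refine ⟨fun e he => ?_, fun i j hij hreach => hij ?_⟩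
  · simp only [cutEdges, Finset.coe_filter, Finset.mem_univ, true_and] at he
    exact he.1
  · have hconst : ∀ u v, (P.graph.deleteEdges (P.cutEdges lab : Set (Sym2 V))).Adj u v →
        lab u = lab v := by
      intro u v huv
      rw [SimpleGraph.deleteEdges_adj] at huv
      by_contra hne
      refine huv.2 ?_
      simp only [cutEdges, Finset.coe_filter, Finset.mem_univ, true_and, Set.mem_ofPred_eq,
        Sym2.map_mk, SimpleGraph.mem_edgeSet]
      exact ⟨huv.1, hne⟩
    have hwalk : ∀ u v, (P.graph.deleteEdges (P.cutEdges lab : Set (Sym2 V))).Walk u v →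
        lab u = lab v := by
      intro u v w
      induction w with
      | nil => rfl
      | cons hadj _ ih => exact (hconst _ _ hadj).trans ih
    obtain ⟨w⟩ := hreach
    rw [← h i, ← h j]
    exact hwalk _ _ w

-- The cost as a sum of indicators over the edges, ready for linearity of expectation.
open Classical in
theorem cost_cutEdges [Fintype V] (x : V → Fin k → ℝ) (ℓ : Labeling k) :
    P.cost (P.cutEdges fun v => ℓ (x v)) =
      ∑ e ∈ Finset.univ.filter (fun e => e ∈ P.graph.edgeSet),
        Set.indicator {ℓ : Labeling k | ¬ (Sym2.map (fun v => ℓ (x v)) e).IsDiag}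
          (fun _ => P.weight e) ℓ := by
  rw [cost, cutEdges, ← Finset.filter_filter, Finset.sum_filter]
  refine Finset.sum_congr rfl fun e _ => ?_
  simp only [Set.indicator_apply, Set.mem_ofPred_eq]

theorem measurableSet_cut (x : V → Fin k → ℝ) (e : Sym2 V) :
    MeasurableSet {ℓ : Labeling k | ¬ (Sym2.map (fun v => ℓ (x v)) e).IsDiag} := by
  induction e using Sym2.ind with
  | _ u v =>
  simp only [Sym2.map_mk, Sym2.mk_isDiag_iff]
  exact measurableSet_label_ne (x u) (x v)

theorem integrable_cost_cutEdges [Fintype V] (R : Measure (Labeling k)) [IsFiniteMeasure R]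
    (x : V → Fin k → ℝ) :
    Integrable (fun ℓ : Labeling k => P.cost (P.cutEdges fun v => ℓ (x v))) R := by
  simp only [P.cost_cutEdges x]
  exact integrable_finsetSum _ fun e _ =>
    (integrable_const _).indicator (measurableSet_cut x e)

theorem integral_cost_cutEdges_le [Fintype V] {R : Measure (Labeling k)} [IsFiniteMeasure R]
    {T : ℝ} (hT : ∀ x ∈ stdSimplex ℝ (Fin k), ∀ y ∈ stdSimplex ℝ (Fin k),
      R.real {ℓ | ℓ x ≠ ℓ y} ≤ T * (1 / 2 * ∑ l, |x l - y l|))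
    {x : V → Fin k → ℝ} (hx : ∀ v, x v ∈ stdSimplex ℝ (Fin k)) :
    ∫ ℓ : Labeling k, P.cost (P.cutEdges fun v => ℓ (x v)) ∂(R) ≤ T * P.relaxedCost x := by
  classical
  simp only [P.cost_cutEdges x]
  rw [integral_finsetSum _ fun e _ => (integrable_const _).indicator (measurableSet_cut x e),
    relaxedCost, Finset.mul_sum]
  refine Finset.sum_le_sum fun e he => ?_
  have hw : 0 ≤ P.weight e := P.weight_nonneg e (Finset.mem_filter.1 he).2
  rw [integral_indicator_const _ (measurableSet_cut x e), smul_eq_mul, mul_left_comm T,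
    mul_comm _ (P.weight e)]
  refine mul_le_mul_of_nonneg_left ?_ hw
  induction e using Sym2.ind with
  | _ u v =>
  simp only [Sym2.map_mk, Sym2.mk_isDiag_iff]
  exact hT _ (hx u) _ (hx v)

end Rounding

/-! ### The relaxation -/

section Relaxation

theorem single_mem_stdSimplex (i : Fin k) : Pi.single i (1 : ℝ) ∈ stdSimplex ℝ (Fin k) := by
  refine ⟨fun l => ?_, by simp⟩
  by_cases h : l = i
  · subst h
    simp
  · simp [h]

theorem isFeasible_of_label {lab : V → Fin k} (h : ∀ i, lab (P.terminal i) = i) :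
    P.IsFeasible fun v => Pi.single (lab v) 1 :=
  ⟨fun v => single_mem_stdSimplex _, fun i => by simp only [h i]⟩

theorem continuous_edgeLength (e : Sym2 V) :
    Continuous fun x : V → Fin k → ℝ => edgeLength x e := by
  induction e using Sym2.ind with
  | _ u v =>
  simp only [edgeLength, Sym2.lift_mk]
  fun_prop

theorem isCompact_isFeasible : IsCompact {x : V → Fin k → ℝ | P.IsFeasible x} := by
  have hcomp : IsCompact (Set.univ.pi fun _ : V => stdSimplex ℝ (Fin k)) :=
    isCompact_univ_pi fun _ => isCompact_stdSimplex ℝ (Fin k)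
  have hclosed : IsClosed {x : V → Fin k → ℝ | ∀ i, x (P.terminal i) = Pi.single i 1} := by
    rw [Set.ofPred_forall]
    exact isClosed_iInter fun i => isClosed_eq (continuous_apply _) continuous_const
  convert hcomp.inter_right hclosed using 1
  ext x
  simp only [IsFeasible, Set.mem_ofPred_eq, Set.mem_inter_iff, Set.mem_univ_pi]

open Classical in
/-- The terminal whose component contains `v` after the removal of `F`. -/
noncomputable def componentLabel [NeZero k] (F : Finset (Sym2 V)) (v : V) : Fin k :=
  if h : ∃ i, (P.graph.deleteEdges (F : Set (Sym2 V))).Reachable (P.terminal i) v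
  then h.choose else 0

-- Adjacent vertices are reachable from the same terminals. Stated as equality of predicates, this
-- makes `choose` return the same index; where no terminal reaches, both get the default `0`.
open Classical in
theorem componentLabel_congr [NeZero k] (F : Finset (Sym2 V)) {u v : V}
    (h : (P.graph.deleteEdges (F : Set (Sym2 V))).Adj u v) :
    P.componentLabel F u = P.componentLabel F v := by
  have hiff : (fun i => (P.graph.deleteEdges (F : Set (Sym2 V))).Reachable (P.terminal i) u) =
      fun i => (P.graph.deleteEdges (F : Set (Sym2 V))).Reachable (P.terminal i) v := by
    funext i
    exact propext ⟨fun hu => hu.trans h.reachable, fun hv => hv.trans h.symm.reachable⟩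
  have hdite : ∀ p q : Fin k → Prop, p = q →
      (if h : ∃ i, p i then h.choose else 0) = if h : ∃ i, q i then h.choose else 0 := by
    rintro p q rfl
    rfl
  exact hdite _ _ hiff

theorem componentLabel_terminal [NeZero k] {F : Finset (Sym2 V)} (hF : P.IsMultiwayCut F)
    (i : Fin k) : P.componentLabel F (P.terminal i) = i := by
  have h : ∃ j, (P.graph.deleteEdges (F : Set (Sym2 V))).Reachable (P.terminal j)
      (P.terminal i) := ⟨i, SimpleGraph.Reachable.refl _⟩
  unfold componentLabel
  rw [dif_pos h]
  by_contra hne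
  exact hF.2 _ _ hne h.choose_spec

theorem edgeLength_single_le (lab : V → Fin k) (e : Sym2 V) :
    edgeLength (fun v => Pi.single (lab v) 1) e ≤ 1 := by
  induction e using Sym2.ind with
  | _ u v =>
  simp only [edgeLength, Sym2.lift_mk]
  have h : ∑ l, |(Pi.single (lab u) (1 : ℝ) : Fin k → ℝ) l -
      (Pi.single (lab v) (1 : ℝ) : Fin k → ℝ) l| ≤
      ∑ l, ((Pi.single (lab u) (1 : ℝ) : Fin k → ℝ) l +
        (Pi.single (lab v) (1 : ℝ) : Fin k → ℝ) l) := by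
    refine Finset.sum_le_sum fun l _ => ?_
    have h1 := (single_mem_stdSimplex (lab u)).1 l
    have h2 := (single_mem_stdSimplex (lab v)).1 l
    exact abs_le.2 ⟨by linarith, by linarith⟩
  rw [Finset.sum_add_distrib, (single_mem_stdSimplex (lab u)).2,
    (single_mem_stdSimplex (lab v)).2] at h
  linarith

/-- Edges outside `F` stay inside a component and have length `0`; edges of `F` have length at most
`1`. -/
theorem relaxedCost_componentLabel_le [Fintype V] [NeZero k] {F : Finset (Sym2 V)}
    (hF : P.IsMultiwayCut F) :
    P.relaxedCost (fun v => Pi.single (P.componentLabel F v) 1) ≤ P.cost F := by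
  classical
  have hsub : F ⊆ Finset.univ.filter (fun e => e ∈ P.graph.edgeSet) := fun e he =>
    Finset.mem_filter.2 ⟨Finset.mem_univ e, hF.1 he⟩
  rw [relaxedCost, cost]
  have hzero : ∀ e ∈ Finset.univ.filter (fun e => e ∈ P.graph.edgeSet), e ∉ F →
      P.weight e * edgeLength (fun v => Pi.single (P.componentLabel F v) 1) e = 0 := by
    intro e he heF
    have he := (Finset.mem_filter.1 he).2
    induction e using Sym2.ind with
    | _ u v =>
    have hadj : (P.graph.deleteEdges (F : Set (Sym2 V))).Adj u v := by
      rw [SimpleGraph.deleteEdges_adj]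
      exact ⟨he, heF⟩
    simp only [edgeLength, Sym2.lift_mk, P.componentLabel_congr F hadj, sub_self, abs_zero,
      Finset.sum_const_zero, mul_zero]
  have hEq := Finset.sum_subset hsub hzero
  refine (le_of_eq ?_).trans (Finset.sum_le_sum fun e he => mul_le_of_le_one_right
    (P.weight_nonneg e (hF.1 he)) (edgeLength_single_le (P.componentLabel F) e))
  rw [hEq]

theorem exists_feasible [NeZero k] : ∃ x, P.IsFeasible x := by
  classical
  refine ⟨_, P.isFeasible_of_label (lab := Function.extend P.terminal id fun _ => 0) fun i => ?_⟩
  exact P.terminal.injective.extend_apply _ _ _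

theorem exists_isOptimal [Fintype V] [NeZero k] : ∃ x, P.IsOptimal x := by
  have hcont : Continuous P.relaxedCost :=
    continuous_finsetSum _ fun e _ => (continuous_edgeLength e).const_mul _
  obtain ⟨x, hx, hmin⟩ := P.isCompact_isFeasible.exists_isMinOn P.exists_feasible
    hcont.continuousOn
  exact ⟨x, hx, fun y hy => hmin hy⟩

theorem IsOptimal.relaxedCost_le_cost [Fintype V] [NeZero k] {P : Problem V k}
    {x : V → Fin k → ℝ} (hx : P.IsOptimal x) {F : Finset (Sym2 V)} (hF : P.IsMultiwayCut F) :
    P.relaxedCost x ≤ P.cost F :=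
  (hx.2 _ (P.isFeasible_of_label (P.componentLabel_terminal hF))).trans
    (P.relaxedCost_componentLabel_le hF)

end Relaxation

end Problem

end MultiwayCut

open MultiwayCut
theorem theorem2 (p₁ p₂ p₃ a b c d : ℝ)
    (hp₁ : p₁ = (6 + 5 * √3) / 26)
    (hp₂ : p₂ = (19 - 8 * √3) / 13)
    (hp₃ : p₃ = (11 * √3 - 18) / 26)
    (hb : b = 2 * √3 - 3)
    (ha : p₂ * a = (12 + 10 * √3) / 39)
    (hc : p₂ * c = (6 + 5 * √3) / 26)
    (hd : p₂ * d = (4 - √3) / 13) :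
    -- the parameters describe a mixture of schemes with probability densities
    (0 ≤ p₁ ∧ 0 ≤ p₂ ∧ 0 ≤ p₃ ∧ p₁ + p₂ + p₃ = 1 ∧ 0 < b ∧ b < 1 ∧
      (∀ u, 0 ≤ phi a b c d u) ∧ IsProbabilityMeasure (densityMeasure (phi a b c d)) ∧
      (∀ u, 0 ≤ psi b u) ∧ IsProbabilityMeasure (densityMeasure (psi b))) ∧
    ∀ (k : ℕ) [NeZero k],
      IsProbabilityMeasure (combinedScheme k p₁ p₂ p₃ a b c d) ∧
      -- the cut density for all edge types at all points of the simplex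
      (∀ (i j : Fin k), i ≠ j → ∀ x ∈ stdSimplex ℝ (Fin k),
        cutDensity (combinedScheme k p₁ p₂ p₃ a b c d) i j x
          ≤ ENNReal.ofReal ((10 + 4 * √3) / 13)) ∧
      -- the approximation guarantee for Multiway Cut
      ∀ {V : Type*} [Fintype V] (P : Problem V k),
        (∃ x, P.IsOptimal x) ∧
        ∀ x, P.IsFeasible x →
          (∀ᵐ ℓ ∂(combinedScheme k p₁ p₂ p₃ a b c d),
            (∀ i, ℓ (x (P.terminal i)) = i) ∧
              P.IsMultiwayCut (P.cutEdges fun v => ℓ (x v))) ∧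
          Integrable (fun ℓ => P.cost (P.cutEdges fun v => ℓ (x v)))
            (combinedScheme k p₁ p₂ p₃ a b c d) ∧
          (∫ ℓ, P.cost (P.cutEdges fun v => ℓ (x v)) ∂(combinedScheme k p₁ p₂ p₃ a b c d)
            ≤ (10 + 4 * √3) / 13 * P.relaxedCost x) ∧
          (P.IsOptimal x → ∀ F : Finset (Sym2 V), P.IsMultiwayCut F →
            ∫ ℓ, P.cost (P.cutEdges fun v => ℓ (x v)) ∂(combinedScheme k p₁ p₂ p₃ a b c d)
              ≤ (10 + 4 * √3) / 13 * P.cost F) := by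
  have h : IsBalanced p₁ p₂ p₃ a b c d := ⟨hp₁, hp₂, hp₃, hb, ha, hc, hd⟩
  refine ⟨⟨h.p₁_pos.le, h.p₂_pos.le, h.p₃_pos.le, h.sum_eq_one, h.b_pos, h.b_lt_one,
    h.phi_nonneg, h.isProbabilityMeasure_phi, h.psi_nonneg, h.isProbabilityMeasure_psi⟩, ?_⟩
  intro k _
  have hprob := h.isProbabilityMeasure_combinedScheme (k := k)
  refine ⟨hprob, fun i j hij x hx => h.cutDensity_le hij hx, fun {V} _ P =>
    ⟨P.exists_isOptimal, fun x hx => ?_⟩⟩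
  have hint := P.integral_cost_cutEdges_le
    (fun y hy z hz => h.combinedScheme_label_ne_le hy hz) hx.1
  refine ⟨?_, P.integrable_cost_cutEdges _ x, hint, fun hopt F hF => hint.trans ?_⟩
  · filter_upwards [ae_all_iff.2 fun i => h.combinedScheme_ae_single i] with ℓ hℓ
    have hterm : ∀ i, ℓ (x (P.terminal i)) = i := fun i => by rw [hx.2 i, hℓ i]
    exact ⟨hterm, P.isMultiwayCut_cutEdges hterm⟩
  · exact mul_le_mul_of_nonneg_left (hopt.relaxedCost_le_cost hF) (by positivity)
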